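/- Let $R$ be a commutative Noetherian local ring with maximal ideal $\mathfrak m$; all modules are finitely generated. Let $\operatorname{CM}(R)$ be the class of maximal Cohen–Macaulay $R$-modules, i.e. the modules $M$ with $M=0$ or $\operatorname{depth} M=\dim R$. For a module $X$ and $i\ge 0$ let $\Omega^iX$ denote the $i$-th syzygy of $X$ in a minimal free resolution ($\Omega^0X=X$). For a class $\mathcal X$ of modules (closed under isomorphism) let $[\mathcal X]$ be the class of all direct summands of finite direct sums of modules isomorphic to $R$ or to $\Omega^iX$ with $i\ge0$ and $X\in\mathcal X$. For classes $\mathcal X,\mathcal Y$ let $\mathcal X\circ\mathcal Y$ be the class of modules $M$ that fit into an exact sequence $0\to X\to M\to Y\to0$ with $X\in\mathcal X$, $Y\in\mathcal Y$, and put $\mathcal X\bullet\mathcal Y=[[\mathcal X]\circ[\mathcal Y]]$. For a module $C$ put $[C]_1=[\{C\}]$ and $[C]_r=[C]_{r-1}\bullet \{C\}$ for $r\ge2$, where $\{C\}$ is the class of modules isomorphic to $C$. The radius of $\mathcal X$, $\operatorname{radius}\mathcal X\in\mathbb N\cup\{\infty\}$, is the infimum of the integers $n\ge0$ such that $\mathcal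 X\subseteq[C]_{n+1}$ for some module $C$. Proposition 10. Suppose that $R$ is a Gorenstein Henselian local ring (Gorenstein meaning that $R$ has finite injective dimension as an $R$-module). Then the following are equivalent: (1) $\operatorname{radius}\operatorname{CM}(R)=0$; (2) $R$ has finite Cohen–Macaulay representation type, i.e. up to isomorphism there are only finitely many indecomposable modules in $\operatorname{CM}(R)$. -/

import Mathlib

universe u

namespace CMRad

open CategoryTheory IsLocalRing

/-- A Gorenstein local ring: a Noetherian local ring which has finite injective dimension as a
module over itself. -/
class IsGorensteinLocalRing (R : Type u) [CommRing R] : Prop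
    extends IsLocalRing R, IsNoetherianRing R where
  injectiveDimension_ne_top : injectiveDimension (ModuleCat.of R R) ≠ ⊤

/-- The depth of a nonzero finitely generated module `M` over a Noetherian local ring: the supremum
of the lengths of the `M`-regular sequences in the maximal ideal.
(A regular sequence `rs` satisfies `M ≠ rs M`, so there is none on the zero module, for which the
value is not meaningful; the zero module is treated separately below.) -/
noncomputable def depth (R : Type u) [CommRing R] [IsLocalRing R]
    (M : Type u) [AddCommGroup M] [Module R M] : ℕ∞ :=
  ⨆ (rs : List R) (_ : (∀ r ∈ rs, r ∈ maximalIdeal R) ∧ RingTheory.Sequence.IsRegular M rs),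
    (rs.length : ℕ∞)

/-- `mod R` is `FGModuleCat R`; a full subcategory of it is given by a property of its objects.
`CM R` is the subcategory of (maximal) Cohen-Macaulay modules: those `M` with
`depth M = dim R`, together with the zero module. -/
def CM (R : Type u) [CommRing R] [IsLocalRing R] : ObjectProperty (FGModuleCat.{u} R) :=
  fun M => Subsingleton M ∨ (depth R M : WithBot ℕ∞) = ringKrullDim R

/-- The ring has finite Cohen-Macaulay representation type: up to isomorphism there are only
finitely many indecomposable modules in `CM R`. -/
def HasFiniteCMType (R : Type u) [CommRing R] [IsLocalRing R] : Prop :=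
  ∃ (n : ℕ) (X : Fin n → FGModuleCat.{u} R),
    (∀ i, CM R (X i) ∧ Indecomposable (X i).obj) ∧
    ∀ M : FGModuleCat.{u} R, CM R M → Indecomposable M.obj → ∃ i, Nonempty (M ≃ₗ[R] X i)

section

variable {R : Type u} [CommRing R]

/-- The subcategory of all modules isomorphic to `C`. -/
def single (C : FGModuleCat.{u} R) : ObjectProperty (FGModuleCat.{u} R) :=
  fun M => Nonempty (M ≃ₗ[R] C)

/-- The additive closure: direct summands of finite direct sums of modules in `P`. -/
def addClosure (P : ObjectProperty (FGModuleCat.{u} R)) : ObjectProperty (FGModuleCat.{u} R) :=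
  fun M => ∃ (n : ℕ) (X : Fin n → FGModuleCat.{u} R) (N : FGModuleCat.{u} R),
    (∀ i, P (X i)) ∧ Nonempty ((M × N) ≃ₗ[R] (∀ i, X i))

/-- `P ∘ Q`: the modules `M` that fit into an exact sequence `0 → X → M → Y → 0` with `X` in `P`
and `Y` in `Q`. -/
def extensions (P Q : ObjectProperty (FGModuleCat.{u} R)) : ObjectProperty (FGModuleCat.{u} R) :=
  fun M => ∃ (X Y : FGModuleCat.{u} R) (f : X →ₗ[R] M) (g : M →ₗ[R] Y),
    P X ∧ Q Y ∧ Function.Injective f ∧ Function.Exact f g ∧ Function.Surjective g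

variable [IsLocalRing R]

/-- `N` is a first syzygy of `M`: there is an exact sequence `0 → N → F → M → 0` with `F` free of
finite rank and the image of `N` contained in `𝔪 F`, i.e. `F → M` is a minimal free cover. -/
def IsFirstSyzygy (M N : FGModuleCat.{u} R) : Prop :=
  ∃ (k : ℕ) (f : N →ₗ[R] (Fin k → R)) (g : (Fin k → R) →ₗ[R] M),
    Function.Injective f ∧ Function.Exact f g ∧ Function.Surjective g ∧
    LinearMap.range f ≤ maximalIdeal R • (⊤ : Submodule R (Fin k → R))

/-- `IsSyzygy i M N`: the module `N` is (isomorphic to) the `i`-th syzygy of `M`, that is, to `M`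
if `i = 0` and to the image of the `i`-th differential of a minimal free resolution of `M` if
`i ≥ 1`. Such a resolution is spliced from minimal free covers. -/
def IsSyzygy : ℕ → FGModuleCat.{u} R → FGModuleCat.{u} R → Prop
  | 0, M, N => Nonempty (N ≃ₗ[R] M)
  | i + 1, M, N => ∃ L : FGModuleCat.{u} R, IsSyzygy i M L ∧ IsFirstSyzygy L N

/-- `[P]`: the additive closure of the subcategory consisting of `R` and all `i`-th syzygies
(`i ≥ 0`) of modules in `P`. -/
def bracket (P : ObjectProperty (FGModuleCat.{u} R)) : ObjectProperty (FGModuleCat.{u} R) :=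
  addClosure fun M => Nonempty (M ≃ₗ[R] R) ∨ ∃ (i : ℕ) (X : FGModuleCat.{u} R), P X ∧ IsSyzygy i X M

/-- `P • Q = [[P] ∘ [Q]]`. -/
def bullet (P Q : ObjectProperty (FGModuleCat.{u} R)) : ObjectProperty (FGModuleCat.{u} R) :=
  bracket (extensions (bracket P) (bracket Q))

/-- The ball `[P]_r` of radius `r ≥ 1` centered at `P`: `[P]_1 = [P]` and
`[P]_r = [P]_{r-1} • P` for `r ≥ 2`. (The value at `r = 0` is not used.) -/
def ball (P : ObjectProperty (FGModuleCat.{u} R)) : ℕ → ObjectProperty (FGModuleCat.{u} R)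
  | 0 => fun M => Subsingleton M
  | 1 => bracket P
  | r + 2 => bullet (ball P (r + 1)) P

/-- The radius of a subcategory `P` of `mod R`: the infimum in `ℕ ∪ {∞}` of the integers `n ≥ 0`
such that `P` is contained in a ball of radius `n + 1` centered at a module. -/
noncomputable def radius (P : ObjectProperty (FGModuleCat.{u} R)) : ℕ∞ :=
  ⨅ (n : ℕ) (_ : ∃ C : FGModuleCat.{u} R, P ≤ ball (single C) (n + 1)), (n : ℕ∞)

end

end CMRad

/-! ### Henselian local rings: lifting factorizations, and local endomorphism rings. -/

section

open Polynomial IsLocalRing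

namespace HenselianLocalRing

variable {R : Type u} [CommRing R] [HenselianLocalRing R]

/-! Finite type gives radius zero by taking for the center the direct sum of the indecomposable CM
modules: a CM module is a finite sum of indecomposables, each of which is again CM, hence it is a
summand of a power of the center.

For the converse, let `CM R` be contained in `[C]`. Over a Henselian ring an indecomposable module
has a local endomorphism ring (`IsIndecomposable.isLocalRing_end`), so a non-free indecomposable CM
module is a summand of a single syzygy of `C`. The issue is to bound the infinitely many syzygies.
As soon as a nonzero CM module exists, the CM modules are those with `Ext^i(-, R) = 0` for `i > 0`
(`cm_iff_isExtAcyclic`). Call these acyclic. Two facts about them make the set `T` of non-free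
indecomposable acyclic classes finite.

Going back along syzygies: if `Ext^i(-, R) = 0` for `i ≥ n`, then `Ω^i C` is acyclic for `i ≥ n`,
and a non-free indecomposable acyclic summand of `Ω^(n+j) C` is the `j`-th syzygy of such a summand
of `Ω^n C` (`IsSyzygyOf.exists_retract`). Hence `T` consists of syzygy iterates of the finite set of
its members that are summands of some `Ω^i C` with `i ≤ n`.

Going back without end: duality into `R` embeds an acyclic module in a free module with acyclic
cokernel (`IsExtAcyclic.exists_cosyzygy`), so every member of `T` is the syzygy of another member of
`T`.

By pigeonhole, an endless backward path through finitely many starting points forces these points to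
be periodic under the syzygy operator. Their orbits are then finite, and so is `T`
(`Set.Finite.of_iterate`). -/

theorem exists_algHom_of_etale {S : Type u} [CommRing S] [Algebra R S] [Algebra.Etale R S]
    (Q : Ideal S) [Q.IsPrime] [Q.LiesOver (maximalIdeal R)]
    (hQ : Function.Surjective (algebraMap R Q.ResidueField)) :
    ∃ φ : S →ₐ[R] R, ∀ y, algebraMap R Q.ResidueField (φ y) = algebraMap S Q.ResidueField y := by
  obtain ⟨s, hs, hstd⟩ := Algebra.IsEtaleAt.exists_isStandardEtale (R := R) Q
  obtain ⟨P⟩ := hstd.nonempty_standardEtalePresentation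
  have hker : ∀ r : R, algebraMap R Q.ResidueField r = 0 ↔ r ∈ maximalIdeal R := by
    intro r
    rw [IsScalarTower.algebraMap_apply R S Q.ResidueField,
      Ideal.algebraMap_residueField_eq_zero, Ideal.over_def Q (maximalIdeal R), Ideal.mem_under]
  have hsu : IsUnit (algebraMap S Q.ResidueField s) := by
    rw [isUnit_iff_ne_zero, ne_eq, Ideal.algebraMap_residueField_eq_zero]
    exact hs
  let χ : Localization.Away s →ₐ[R] Q.ResidueField :=
    IsLocalization.Away.liftAlgHom s (f := IsScalarTower.toAlgHom R S Q.ResidueField) hsu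
  have hχ : ∀ y : S, χ (algebraMap S _ y) = algebraMap S Q.ResidueField y := by
    intro y
    exact IsLocalization.Away.lift_eq s (g := algebraMap S Q.ResidueField) hsu y
  obtain ⟨a₀, ha₀⟩ := hQ (χ P.x)
  have hm : P.P.HasMap (χ P.x) := P.hasMap.map χ
  have hev : ∀ (q : R[X]) (b : R), aeval (algebraMap R Q.ResidueField b) q =
      algebraMap R Q.ResidueField (q.eval b) := by
    intro q b
    rw [aeval_algebraMap_apply, coe_aeval_eq_eval]
  have h1 : P.f.eval a₀ ∈ maximalIdeal R := by
    rw [← hker, ← hev, ha₀]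
    exact hm.1
  have hunit : ∀ r : R, IsUnit (algebraMap R Q.ResidueField r) → IsUnit r := by
    intro r hr
    by_contra h
    rw [(hker r).2 ((mem_maximalIdeal r).2 h)] at hr
    exact not_isUnit_zero hr
  have h2 : IsUnit (P.f.derivative.eval a₀) := by
    apply hunit
    rw [← hev, ha₀]
    exact hm.isUnit_derivative_f
  -- Near `Q` the algebra is standard étale with generator `P.x`. Hensel's lemma lifts the residue
  -- of `P.x` to a root of `P.f`, and sending `P.x` to this root defines the section.
  obtain ⟨a, ha, haa⟩ := HenselianLocalRing.is_henselian P.f P.monic_f a₀ h1 h2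
  have haeq : algebraMap R Q.ResidueField a = χ P.x := by
    rw [← ha₀, ← sub_eq_zero, ← map_sub, hker]
    exact haa
  have hma : P.P.HasMap a := by
    refine ⟨by simpa [IsRoot] using ha, ?_⟩
    rw [coe_aeval_eq_eval]
    apply hunit
    rw [← hev, haeq]
    exact hm.2
  let ψ : Localization.Away s →ₐ[R] R := (P.P.lift a hma).comp P.equivRing.toAlgHom
  refine ⟨ψ.comp (IsScalarTower.toAlgHom R S _), fun y => ?_⟩
  have key : (Algebra.ofId R Q.ResidueField).comp ψ = χ := by
    apply P.hom_ext
    change algebraMap R Q.ResidueField (P.P.lift a hma (P.equivRing P.x)) = _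
    rw [P.equivRing_x, P.P.lift_X, haeq]
  have := DFunLike.congr_fun key (algebraMap S _ y)
  rw [hχ] at this
  exact this

/-- The factorization lifts over an étale algebra with the same residue field at a point over the
maximal ideal. Over a Henselian ring that algebra has a section, which carries the lift back to `R`.
-/
theorem exists_factorization_lift (p : R[X]) (hp : p.Monic)
    (f g : (maximalIdeal R).ResidueField[X]) (hf : f.Monic) (hg : g.Monic)
    (H : p.map (algebraMap R _) = f * g) (hfg : IsCoprime f g) :
    ∃ f' g' : R[X], p = f' * g' ∧ IsCoprime f' g' ∧
      f'.map (algebraMap R _) = f ∧ g'.map (algebraMap R _) = g := by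
  obtain ⟨S, _, _, _, Q, _, _, f₁, g₁, hbij, hf₁, hg₁, hmul, hcop, hff, hgg⟩ :=
    Algebra.exists_etale_bijective_residueFieldMap_and_map_eq_mul_and_isCoprime
      (maximalIdeal R) p f g hp hf hg H hfg
  set ι := Ideal.ResidueField.mapₐ (maximalIdeal R) Q (Algebra.ofId _ _)
    (Ideal.over_def Q (maximalIdeal R)) with hι
  have hιc : ι.toRingHom.comp (algebraMap R (maximalIdeal R).ResidueField) =
      algebraMap R Q.ResidueField := ι.comp_algebraMap
  have hsurj : Function.Surjective (algebraMap R Q.ResidueField) := by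
    rw [← hιc]
    exact hbij.2.comp (Ideal.algebraMap_residueField_surjective _)
  obtain ⟨φ, hφ⟩ := exists_algHom_of_etale Q hsurj
  have hφ' : (algebraMap R Q.ResidueField).comp φ.toRingHom = algebraMap S Q.ResidueField :=
    RingHom.ext hφ
  have hinj : Function.Injective (Polynomial.map ι.toRingHom) :=
    Polynomial.map_injective _ hbij.1
  have hres : ∀ (q : (maximalIdeal R).ResidueField[X]) (q₁ : S[X]),
      q.map ι.toRingHom = q₁.map (algebraMap S Q.ResidueField) →
      (q₁.map φ.toRingHom).map (algebraMap R _) = q := by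
    intro q q₁ h
    apply hinj
    rw [h, Polynomial.map_map, Polynomial.map_map, hιc, hφ']
  refine ⟨f₁.map φ.toRingHom, g₁.map φ.toRingHom, ?_, ?_, hres f f₁ hff, hres g g₁ hgg⟩
  · rw [← Polynomial.map_mul, ← hmul, Polynomial.map_map]
    have : φ.toRingHom.comp (algebraMap R S) = RingHom.id R := φ.comp_algebraMap
    rw [this, Polynomial.map_id]
  · exact hcop.map (Polynomial.mapRingHom φ.toRingHom)

end HenselianLocalRing

namespace Module

/-- A module is indecomposable if it is nonzero and not a direct sum of two nonzero modules. -/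
def IsIndecomposable (R : Type u) [CommRing R] (M : Type u) [AddCommGroup M] [Module R M] : Prop :=
  Nontrivial M ∧ ∀ (Y Z : Type u) [AddCommGroup Y] [AddCommGroup Z] [Module R Y] [Module R Z],
    (M ≃ₗ[R] Y × Z) → Subsingleton Y ∨ Subsingleton Z

variable {R : Type u} [CommRing R] {M : Type u} [AddCommGroup M] [Module R M]

/-- `X - a` divides `q - q(a)`, so `f - a` divides `q(f) - q(a) = -q(a)`, which is a unit. -/
theorem End.isUnit_sub_algebraMap_of_aeval_eq_zero {f : Module.End R M} {q : R[X]} {a : R}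
    (hq : aeval f q = 0) (ha : IsUnit (q.eval a)) : IsUnit (f - algebraMap R _ a) := by
  obtain ⟨h, hh⟩ := X_sub_C_dvd_sub_C_eval (p := q) (a := a)
  have h1 := congrArg (aeval f) hh
  rw [map_sub, map_mul, hq, map_sub, aeval_X, aeval_C, aeval_C, zero_sub] at h1
  have h2 : IsUnit ((f - algebraMap R _ a) * aeval f h) := by
    rw [← h1]
    exact (ha.map (algebraMap R (Module.End R M))).neg
  have hc : Commute (f - algebraMap R _ a) (aeval f h) := by
    have : f - algebraMap R _ a = aeval f (X - C a) := by simp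
    rw [this, Commute, SemiconjBy, ← map_mul, mul_comm, map_mul]
  exact (hc.isUnit_mul_iff.1 h2).1

/-- Fitting's lemma in Henselian form. By Cayley–Hamilton `f` is a root of a monic `p`. Modulo the
maximal ideal `p` is `X ^ r` times a factor prime to `X`, and the lifted coprime factors split `M`
as a direct sum of two kernels, one of which must vanish. -/
theorem IsIndecomposable.isLocalRing_end [HenselianLocalRing R] [Module.Finite R M]
    (hM : IsIndecomposable R M) : IsLocalRing (Module.End R M) := by
  have := hM.1
  refine .of_isUnit_or_isUnit_one_sub_self fun f => ?_
  obtain ⟨p, hp, hpf⟩ := LinearMap.exists_monic_and_aeval_eq_zero R f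
  set κ := (maximalIdeal R).ResidueField
  have hpb : (p.map (algebraMap R κ)).Monic := hp.map _
  obtain ⟨q, hq, hqd⟩ := exists_eq_pow_rootMultiplicity_mul_and_not_dvd
    (p.map (algebraMap R κ)) hpb.ne_zero 0
  set r := rootMultiplicity 0 (p.map (algebraMap R κ))
  rw [C_0, sub_zero] at hq hqd
  have hqm : q.Monic := (monic_X_pow r).of_mul_monic_left (hq ▸ hpb)
  have hcop : IsCoprime (X ^ r) q :=
    IsCoprime.pow_left ((irreducible_X.coprime_iff_not_dvd).2 hqd)
  obtain ⟨f₁, g₁, hfg, hc, hf₁, hg₁⟩ := HenselianLocalRing.exists_factorization_lift p hp _ q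
    (monic_X_pow r) hqm hq hcop
  have hunit : ∀ (s : R[X]) (a : R),
      (s.map (algebraMap R κ)).eval (algebraMap R κ a) ≠ 0 → IsUnit (s.eval a) := by
    intro s a hs
    by_contra h
    apply hs
    rw [eval_map_algebraMap, aeval_algebraMap_apply, coe_aeval_eq_eval,
      Ideal.algebraMap_residueField_eq_zero]
    exact (mem_maximalIdeal _).2 h
  have hsup := Polynomial.sup_ker_aeval_eq_ker_aeval_mul_of_coprime f hc
  rw [← hfg, hpf, LinearMap.ker_zero] at hsup
  have hcompl : IsCompl (LinearMap.ker (aeval f f₁)) (LinearMap.ker (aeval f g₁)) :=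
    ⟨Polynomial.disjoint_ker_aeval_of_isCoprime f hc, codisjoint_iff.2 hsup⟩
  rcases hM.2 _ _ (Submodule.prodEquivOfIsCompl _ _ hcompl).symm with h | h
  · left
    rw [Submodule.subsingleton_iff_eq_bot] at h
    rw [h, bot_sup_eq] at hsup
    -- Here `g₁` kills `f`, and `g₁(0)` is a unit because `X` does not divide the reduction `q`.
    have := End.isUnit_sub_algebraMap_of_aeval_eq_zero (a := 0) (LinearMap.ker_eq_top.1 hsup)
      (hunit _ _ (by
        rw [hg₁, map_zero, ← coeff_zero_eq_eval_zero]
        exact fun h0 => hqd (X_dvd_iff.2 h0)))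
    simpa using this
  · right
    rw [Submodule.subsingleton_iff_eq_bot] at h
    rw [h, sup_bot_eq] at hsup
    -- Here `f₁` kills `f`, and `f₁(1)` reduces to `1 ^ r = 1`.
    have := End.isUnit_sub_algebraMap_of_aeval_eq_zero (a := 1) (LinearMap.ker_eq_top.1 hsup)
      (hunit _ _ (by rw [hf₁]; simp))
    rw [map_one] at this
    simpa using this.neg

end Module

end

/-! ### Direct summands and decomposition into indecomposables. -/

section

namespace Module

/-- `M` is (isomorphic to) a direct summand of `N`. -/
def IsRetract (R : Type u) [CommRing R] (M N : Type u) [AddCommGroup M] [Module R M]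
    [AddCommGroup N] [Module R N] : Prop :=
  ∃ (i : M →ₗ[R] N) (p : N →ₗ[R] M), p ∘ₗ i = LinearMap.id

section

variable {R : Type u} [CommRing R] {M N P : Type u} [AddCommGroup M] [Module R M]
  [AddCommGroup N] [Module R N] [AddCommGroup P] [Module R P]

theorem IsRetract.of_equiv (e : M ≃ₗ[R] N) : IsRetract R M N :=
  ⟨e, e.symm, by ext; simp⟩

theorem IsRetract.refl : IsRetract R M M := .of_equiv (.refl R M)

theorem IsRetract.trans (h : IsRetract R M N) (h' : IsRetract R N P) : IsRetract R M P := by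
  obtain ⟨i, p, hp⟩ := h
  obtain ⟨j, q, hq⟩ := h'
  refine ⟨j ∘ₗ i, p ∘ₗ q, ?_⟩
  rw [LinearMap.comp_assoc, ← LinearMap.comp_assoc i, hq, LinearMap.id_comp, hp]

theorem IsRetract.fst (e : (M × N) ≃ₗ[R] P) : IsRetract R M P :=
  IsRetract.trans ⟨.inl R M N, .fst R M N, by ext; simp⟩ (.of_equiv e)

theorem IsRetract.proj {ι : Type} [DecidableEq ι] (X : ι → Type u) [∀ i, AddCommGroup (X i)]
    [∀ i, Module R (X i)] (e : P ≃ₗ[R] ∀ i, X i) (i : ι) : IsRetract R (X i) P :=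
  IsRetract.trans ⟨.single R X i, .proj i, by ext; simp⟩ (.of_equiv e.symm)

/-- The complement of a direct summand. -/
theorem IsRetract.exists_prod_equiv (h : IsRetract R M N) :
    ∃ p : N →ₗ[R] M, Nonempty ((M × LinearMap.ker p) ≃ₗ[R] N) := by
  obtain ⟨i, p, hp⟩ := h
  have hp' : ∀ x, p (i x) = x := fun x => LinearMap.congr_fun hp x
  refine ⟨p, ⟨.ofLinearMap (i.coprod (LinearMap.ker p).subtype)
    (p.prod ((LinearMap.id - i ∘ₗ p).codRestrict _ fun x => by simp [hp'])) ?_ ?_⟩⟩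
  · ext x
    simp
  · ext x <;> simp [hp']

/-- The identity of `M` is the sum of its components through the `X i`. In a local ring one of these
summands is a unit. -/
theorem IsRetract.exists_of_pi [IsLocalRing (Module.End R M)] {ι : Type} [Fintype ι]
    (X : ι → Type u) [∀ i, AddCommGroup (X i)] [∀ i, Module R (X i)]
    (h : IsRetract R M (∀ i, X i)) : ∃ i, IsRetract R M (X i) := by
  classical
  obtain ⟨i, p, hp⟩ := h
  let f : ι → Module.End R M := fun j => p ∘ₗ .single R X j ∘ₗ .proj j ∘ₗ i
  have hf : ∑ j, f j = 1 := by
    rw [Module.End.one_eq_id, ← hp]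
    ext x
    have : i x = ∑ j, Pi.single j (i x j) := (Finset.univ_sum_single (i x)).symm
    conv_rhs => rw [LinearMap.comp_apply, this, map_sum]
    simp [f]
  obtain ⟨j, -, hj⟩ := IsLocalRing.exists_of_isUnit_sum (hf ▸ isUnit_one : IsUnit (∑ j, f j))
  obtain ⟨u, hu⟩ := hj
  refine ⟨j, .proj j ∘ₗ i, (↑u⁻¹ : Module.End R M) ∘ₗ p ∘ₗ .single R X j, ?_⟩
  have : (↑u⁻¹ : Module.End R M) * f j = 1 := by rw [← hu]; simp
  exact this

theorem _root_.IsLocalRing.isUnit_or_isUnit_one_sub {A : Type*} [Ring A] [IsLocalRing A] (a : A) :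
    IsUnit a ∨ IsUnit (1 - a) :=
  IsLocalRing.isUnit_or_isUnit_of_add_one (add_sub_cancel a 1)

/-- The idempotent `i ∘ p` of a local ring is `0` or `1`, and `0` is excluded since `M` is nonzero.
-/
theorem IsRetract.equiv_of_isLocalRing [Nontrivial M] [IsLocalRing (Module.End R N)]
    (h : IsRetract R M N) : Nonempty (M ≃ₗ[R] N) := by
  obtain ⟨i, p, hp⟩ := h
  have hp' : ∀ x, p (i x) = x := fun x => LinearMap.congr_fun hp x
  have hidem : (i ∘ₗ p : Module.End R N) * (1 - i ∘ₗ p) = 0 := by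
    ext x
    simp [hp']
  rcases IsLocalRing.isUnit_or_isUnit_one_sub (i ∘ₗ p : Module.End R N) with h | h
  · have h1 : (1 - i ∘ₗ p : Module.End R N) = 0 := h.mul_right_eq_zero.1 hidem
    exact ⟨.ofLinearMap i p (by rw [← sub_eq_zero, ← neg_sub, neg_eq_zero]; exact h1) hp⟩
  · have h1 : (i ∘ₗ p : Module.End R N) = 0 := h.mul_left_eq_zero.1 hidem
    obtain ⟨x, hx⟩ := exists_ne (0 : M)
    refine (hx ?_).elim
    have := LinearMap.congr_fun h1 (i x)
    simp only [LinearMap.comp_apply, hp', LinearMap.zero_apply] at this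
    rw [← hp' x, this, map_zero]

theorem nontrivial_of_isLocalRing_end [IsLocalRing (Module.End R M)] : Nontrivial M := by
  by_contra h
  rw [not_nontrivial_iff_subsingleton] at h
  exact zero_ne_one (α := Module.End R M) (Subsingleton.elim _ _)

end

/-- A finite direct sum of indecomposable modules. -/
def IsSumOfIndecomposables (R : Type u) [CommRing R] (M : Type u) [AddCommGroup M] [Module R M] :
    Prop :=
  ∃ (n : ℕ) (X : Fin n → ModuleCat.{u} R), (∀ i, IsIndecomposable R (X i)) ∧
    Nonempty (M ≃ₗ[R] ∀ i, X i)

section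

variable {R : Type u} [CommRing R] {M N : Type u} [AddCommGroup M] [Module R M]
  [AddCommGroup N] [Module R N]

theorem IsSumOfIndecomposables.congr (e : M ≃ₗ[R] N) (h : IsSumOfIndecomposables R M) :
    IsSumOfIndecomposables R N := by
  obtain ⟨n, X, hX, ⟨f⟩⟩ := h
  exact ⟨n, X, hX, ⟨e.symm.trans f⟩⟩

theorem IsSumOfIndecomposables.prod (hM : IsSumOfIndecomposables R M)
    (hN : IsSumOfIndecomposables R N) : IsSumOfIndecomposables R (M × N) := by
  obtain ⟨m, X, hX, ⟨e⟩⟩ := hM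
  obtain ⟨n, Y, hY, ⟨f⟩⟩ := hN
  let Z : Fin m ⊕ Fin n → ModuleCat.{u} R := Sum.elim X Y
  have hZ : ∀ i, IsIndecomposable R (Z i) := by
    rintro (i | i)
    · exact hX i
    · exact hY i
  refine ⟨m + n, fun i => Z (finSumFinEquiv.symm i), fun i => hZ _, ⟨?_⟩⟩
  have e₁ : (M × N) ≃ₗ[R] (∀ i, X i) × (∀ i, Y i) := e.prodCongr f
  have e₂ : ((∀ i, X i) × (∀ i, Y i)) ≃ₗ[R] ∀ i, Z i :=
    (LinearEquiv.sumPiEquivProdPi R (Fin m) (Fin n) (fun i => Z i)).symm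
  exact (e₁.trans e₂).trans (LinearEquiv.piCongrLeft' R (fun i => (Z i : Type u)) finSumFinEquiv)

theorem isSumOfIndecomposables_of_isNoetherian [IsNoetherian R M] :
    IsSumOfIndecomposables R M := by
  -- Noetherian induction over kernels: the two factors of a nontrivial decomposition of `M ⧸ N` are
  -- quotients of `M` by strictly larger submodules.
  suffices h : ∀ N : Submodule R M, IsSumOfIndecomposables R (M ⧸ N) from
    (h ⊥).congr (Submodule.quotEquivOfEqBot ⊥ rfl)
  intro N
  induction N using WellFoundedGT.induction with
  | ind N ih =>
  by_cases hi : IsIndecomposable R (M ⧸ N)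
  · exact ⟨1, fun _ => ModuleCat.of R (M ⧸ N), fun _ => hi,
      ⟨(LinearEquiv.funUnique (Fin 1) R (M ⧸ N)).symm⟩⟩
  by_cases hn : Nontrivial (M ⧸ N)
  · rw [IsIndecomposable] at hi
    push Not at hi
    obtain ⟨Y, Z, _, _, _, _, e, hY, hZ⟩ := hi hn
    have aux : ∀ (W : Type u) [AddCommGroup W] [Module R W] (f : (M ⧸ N) →ₗ[R] W),
        Function.Surjective f → ¬ Function.Injective f → IsSumOfIndecomposables R W := by
      intro W _ _ f hf hf'
      let g := f ∘ₗ N.mkQ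
      have hg : Function.Surjective g := hf.comp N.mkQ_surjective
      refine (ih (LinearMap.ker g) (lt_of_le_of_ne ?_ ?_)).congr (g.quotKerEquivOfSurjective hg)
      · intro x hx
        have : N.mkQ x = 0 := by simpa using hx
        simp [g, this]
      · intro h
        apply hf'
        rw [← LinearMap.ker_eq_bot, eq_bot_iff]
        intro x hx
        obtain ⟨x, rfl⟩ := N.mkQ_surjective x
        have : x ∈ N := by rw [h]; exact hx
        simpa using this
    refine IsSumOfIndecomposables.congr e.symm (.prod ?_ ?_)
    · refine aux Y (.fst R Y Z ∘ₗ e) (Prod.fst_surjective.comp e.surjective) fun h => ?_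
      obtain ⟨z, hz⟩ := exists_ne (0 : Z)
      have := @h (e.symm (0, z)) 0 (by simp)
      simp [hz] at this
    · refine aux Z (.snd R Y Z ∘ₗ e) (Prod.snd_surjective.comp e.surjective) fun h => ?_
      obtain ⟨z, hz⟩ := exists_ne (0 : Y)
      have := @h (e.symm (z, 0)) 0 (by simp)
      simp [hz] at this
  · rw [not_nontrivial_iff_subsingleton] at hn
    exact ⟨0, fun _ => ModuleCat.of R (M ⧸ N), fun i => i.elim0,
      ⟨LinearEquiv.ofSubsingleton _ _⟩⟩

end

open CategoryTheory in
theorem isIndecomposable_iff {R : Type u} [CommRing R] (M : ModuleCat.{u} R) :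
    Indecomposable M ↔ IsIndecomposable R M := by
  rw [Indecomposable, IsIndecomposable, ModuleCat.isZero_iff_subsingleton,
    not_subsingleton_iff_nontrivial]
  refine and_congr_right fun _ => ⟨fun h Y Z _ _ _ _ e => ?_, fun h Y Z e => ?_⟩
  · have := h (ModuleCat.of R Y) (ModuleCat.of R Z)
      ((e.toModuleIso : ModuleCat.of R M ≅ ModuleCat.of R (Y × Z)) ≪≫
        (ModuleCat.biprodIsoProd (.of R Y) (.of R Z)).symm)
    simpa [ModuleCat.isZero_iff_subsingleton] using this
  · rw [ModuleCat.isZero_iff_subsingleton, ModuleCat.isZero_iff_subsingleton]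
    exact h Y Z (e ≪≫ ModuleCat.biprodIsoProd _ _).toLinearEquiv

end Module

end

/-! ### Vanishing of `Ext` into `R`, depth, and Cohen–Macaulay modules over Gorenstein rings. -/

section

open CategoryTheory CategoryTheory.Abelian IsLocalRing RingTheory.Sequence

namespace Module

/-- The vanishing of `Ext^i(M, R)`. -/
def ExtVanishes (R : Type u) [CommRing R] (i : ℕ) (M : Type u) [AddCommGroup M] [Module R M] :
    Prop :=
  Subsingleton (Ext (ModuleCat.of R M) (ModuleCat.of R R) i)

section

variable {R : Type u} [CommRing R] {A B C : Type u} [AddCommGroup A] [Module R A]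
  [AddCommGroup B] [Module R B] [AddCommGroup C] [Module R C]

theorem extVanishes_zero_iff : ExtVanishes R 0 A ↔ Subsingleton (A →ₗ[R] R) :=
  (Ext.addEquiv₀.trans ModuleCat.homAddEquiv).subsingleton_congr

theorem ExtVanishes.congr {i : ℕ} (e : A ≃ₗ[R] B) (h : ExtVanishes R i A) : ExtVanishes R i B := by
  have h' : Subsingleton (Ext (ModuleCat.of R A) (ModuleCat.of R R) i) := h
  refine ⟨fun x y => ?_⟩
  have hx : ∀ x : Ext (ModuleCat.of R B) (ModuleCat.of R R) i, x = 0 := by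
    intro x
    have h1 : (Ext.mk₀ e.toModuleIso.inv).comp ((Ext.mk₀ e.toModuleIso.hom).comp x (zero_add i))
        (zero_add i) = x := by
      rw [Ext.mk₀_comp_mk₀_assoc, Iso.inv_hom_id, Ext.mk₀_id_comp]
    rw [← h1, Subsingleton.elim ((Ext.mk₀ e.toModuleIso.hom).comp x (zero_add i)) 0, Ext.comp_zero]
  rw [hx x, hx y]

theorem extVanishes_succ_of_projective [Module.Projective R A] (i : ℕ) :
    ExtVanishes R (i + 1) A := by
  have : CategoryTheory.Projective (ModuleCat.of R A) :=
    (IsProjective.iff_projective A).1 inferInstance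
  exact ⟨fun x y => by rw [Ext.eq_zero_of_projective x, Ext.eq_zero_of_projective y]⟩

theorem IsRetract.extVanishes {i : ℕ} (h : IsRetract R A B) (hB : ExtVanishes R i B) :
    ExtVanishes R i A := by
  obtain ⟨j, p, hp⟩ := h
  have h' : Subsingleton (Ext (ModuleCat.of R B) (ModuleCat.of R R) i) := hB
  have hx : ∀ x : Ext (ModuleCat.of R A) (ModuleCat.of R R) i, x = 0 := by
    intro x
    have h1 : (Ext.mk₀ (ModuleCat.ofHom j)).comp ((Ext.mk₀ (ModuleCat.ofHom p)).comp x (zero_add i))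
        (zero_add i) = x := by
      rw [Ext.mk₀_comp_mk₀_assoc, ← ModuleCat.ofHom_comp, hp, ModuleCat.ofHom_id, Ext.mk₀_id_comp]
    rw [← h1, Subsingleton.elim ((Ext.mk₀ (ModuleCat.ofHom p)).comp x (zero_add i)) 0,
      Ext.comp_zero]
  exact ⟨fun x y => by rw [hx x, hx y]⟩

variable {f : A →ₗ[R] B} {g : B →ₗ[R] C}

theorem shortExact_of_exact (hf : Function.Injective f) (hfg : Function.Exact f g)
    (hg : Function.Surjective g) :
    (ModuleCat.shortComplexOfCompEqZero f g hfg.linearMap_comp_eq_zero).ShortExact :=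
  ModuleCat.shortComplex_shortExact _ hfg hf hg

variable (hf : Function.Injective f) (hfg : Function.Exact f g) (hg : Function.Surjective g)
include hf hfg hg

theorem ExtVanishes.middle {i : ℕ} (hA : ExtVanishes R i A) (hC : ExtVanishes R i C) :
    ExtVanishes R i B := by
  have hA' : Subsingleton (Ext (ModuleCat.of R A) (ModuleCat.of R R) i) := hA
  have hC' : Subsingleton (Ext (ModuleCat.of R C) (ModuleCat.of R R) i) := hC
  have hx : ∀ x : Ext (ModuleCat.of R B) (ModuleCat.of R R) i, x = 0 := by
    intro x
    obtain ⟨y, rfl⟩ := Ext.contravariant_sequence_exact₂ (shortExact_of_exact hf hfg hg) _ x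
      (Subsingleton.elim _ _)
    rw [Subsingleton.elim y 0, Ext.comp_zero]
  exact ⟨fun x y => by rw [hx x, hx y]⟩

theorem ExtVanishes.left {i : ℕ} (hB : ExtVanishes R i B) (hC : ExtVanishes R (i + 1) C) :
    ExtVanishes R i A := by
  have hB' : Subsingleton (Ext (ModuleCat.of R B) (ModuleCat.of R R) i) := hB
  have hC' : Subsingleton (Ext (ModuleCat.of R C) (ModuleCat.of R R) (i + 1)) := hC
  have hx : ∀ x : Ext (ModuleCat.of R A) (ModuleCat.of R R) i, x = 0 := by
    intro x
    obtain ⟨y, rfl⟩ := Ext.contravariant_sequence_exact₁ (shortExact_of_exact hf hfg hg) _ x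
      (add_comm 1 i) (Subsingleton.elim _ _)
    rw [Subsingleton.elim y 0, Ext.comp_zero]
  exact ⟨fun x y => by rw [hx x, hx y]⟩

theorem ExtVanishes.right {i : ℕ} (hA : ExtVanishes R i A) (hB : ExtVanishes R (i + 1) B) :
    ExtVanishes R (i + 1) C := by
  have hA' : Subsingleton (Ext (ModuleCat.of R A) (ModuleCat.of R R) i) := hA
  have hB' : Subsingleton (Ext (ModuleCat.of R B) (ModuleCat.of R R) (i + 1)) := hB
  have hx : ∀ x : Ext (ModuleCat.of R C) (ModuleCat.of R R) (i + 1), x = 0 := by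
    intro x
    obtain ⟨y, rfl⟩ := Ext.contravariant_sequence_exact₃ (shortExact_of_exact hf hfg hg) _ x
      (Subsingleton.elim _ _) (add_comm 1 i)
    rw [Subsingleton.elim y 0, Ext.comp_zero]
  exact ⟨fun x y => by rw [hx x, hx y]⟩

/-- If `Ext^1(C, R) = 0` then functionals extend along `A → B`. -/
theorem ExtVanishes.exists_extension (hC : ExtVanishes R 1 C) (φ : A →ₗ[R] R) :
    ∃ ψ : B →ₗ[R] R, ψ ∘ₗ f = φ := by
  have hC' : Subsingleton (Ext (ModuleCat.of R C) (ModuleCat.of R R) 1) := hC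
  obtain ⟨y, hy⟩ := Ext.contravariant_sequence_exact₁ (shortExact_of_exact hf hfg hg) _
    (Ext.mk₀ (ModuleCat.ofHom φ)) (add_zero 1) (Subsingleton.elim _ _)
  obtain ⟨ψ, rfl⟩ := Ext.addEquiv₀.symm.surjective y
  change (Ext.mk₀ _).comp (Ext.mk₀ ψ) _ = _ at hy
  rw [Ext.mk₀_comp_mk₀] at hy
  have := Ext.addEquiv₀.symm.injective (a₁ := _ ≫ ψ) (a₂ := ModuleCat.ofHom φ) hy
  exact ⟨ψ.hom, congrArg ModuleCat.Hom.hom this⟩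

/-- The connecting map from `Hom(A, R)` onto `Ext^1(C, R)` kills every functional that extends to
`B`. -/
theorem extVanishes_one_of_exists_extension (hB : ExtVanishes R 1 B)
    (h : ∀ φ : A →ₗ[R] R, ∃ ψ : B →ₗ[R] R, ψ ∘ₗ f = φ) : ExtVanishes R 1 C := by
  have hB' : Subsingleton (Ext (ModuleCat.of R B) (ModuleCat.of R R) 1) := hB
  have hx : ∀ x : Ext (ModuleCat.of R C) (ModuleCat.of R R) 1, x = 0 := by
    intro x
    have hS := shortExact_of_exact hf hfg hg
    obtain ⟨y, rfl⟩ := Ext.contravariant_sequence_exact₃ hS _ x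
      (Subsingleton.elim _ _) (add_zero 1)
    obtain ⟨φ, rfl⟩ := Ext.addEquiv₀.symm.surjective y
    obtain ⟨ψ, hψ⟩ := h φ.hom
    have : φ = ModuleCat.ofHom f ≫ ModuleCat.ofHom ψ := by
      rw [← ModuleCat.ofHom_comp, hψ]
      rfl
    rw [this]
    change hS.extClass.comp (Ext.mk₀ (_ ≫ _)) _ = 0
    rw [← Ext.mk₀_comp_mk₀]
    exact hS.extClass_comp_assoc _
  exact ⟨fun x y => by rw [hx x, hx y]⟩

omit hf hfg in
theorem ExtVanishes.zero_right (hB : ExtVanishes R 0 B) : ExtVanishes R 0 C := by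
  rw [extVanishes_zero_iff] at *
  refine ⟨fun φ ψ => ?_⟩
  have := Subsingleton.elim (φ ∘ₗ g) (ψ ∘ₗ g)
  ext c
  obtain ⟨b, rfl⟩ := hg c
  exact LinearMap.congr_fun this b

end

section Local

variable {R : Type u} [CommRing R] [IsLocalRing R] [IsNoetherianRing R] {M : Type u}
  [AddCommGroup M] [Module R M]

open Pointwise in
omit [IsLocalRing R] [IsNoetherianRing R] in
theorem exact_quotSMulTop (x : R) : Function.Exact (LinearMap.lsmul R M x)
    (x • (⊤ : Submodule R M)).mkQ := LinearMap.exact_lsmul_mkQ_smul_top M x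

/-- If `x ∈ 𝔪` is regular on `M` and `Ext^{i+1}(M/xM, R) = 0`, then `Ext^i(M, R) = 0` by
Nakayama's lemma. -/
theorem ExtVanishes.of_quotSMulTop [Module.Finite R M] {x : R} (hx : x ∈ maximalIdeal R)
    (hreg : IsSMulRegular M x) {i : ℕ} (h : ExtVanishes R (i + 1) (QuotSMulTop x M)) :
    ExtVanishes R i M := by
  have h' : Subsingleton (Ext (ModuleCat.of R (QuotSMulTop x M)) (ModuleCat.of R R) (i + 1)) := h
  have hinj : Function.Injective (LinearMap.lsmul R M x) := hreg
  have hsurj : ∀ y : Ext (ModuleCat.of R M) (ModuleCat.of R R) i,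
      ∃ z : Ext (ModuleCat.of R M) (ModuleCat.of R R) i, x • z = y := by
    intro y
    obtain ⟨z, hz⟩ := Ext.contravariant_sequence_exact₁
      (shortExact_of_exact hinj (exact_quotSMulTop x) (Submodule.mkQ_surjective _)) _ y
      (add_comm 1 i) (Subsingleton.elim _ _)
    refine ⟨z, ?_⟩
    rw [← hz]
    change _ = (Ext.mk₀ (ModuleCat.ofHom (LinearMap.lsmul R M x))).comp
      (X := ModuleCat.of R M) (Y := ModuleCat.of R M) z _
    have h1 : ModuleCat.ofHom (LinearMap.lsmul R M x) = x • 𝟙 (ModuleCat.of R M) := rfl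
    rw [h1, Ext.mk₀_smul, Ext.smul_comp, Ext.mk₀_id_comp]
  have htop : (⊤ : Submodule R (Ext (ModuleCat.of R M) (ModuleCat.of R R) i)) = ⊥ := by
    refine Submodule.eq_bot_of_le_smul_of_le_jacobson_bot (maximalIdeal R) _ Module.Finite.fg_top
      (fun y _ => ?_) (IsLocalRing.maximalIdeal_le_jacobson _)
    obtain ⟨z, rfl⟩ := hsurj y
    exact Submodule.smul_mem_smul hx trivial
  exact (Submodule.subsingleton_iff R).1 (subsingleton_of_bot_eq_top htop.symm)

variable {n : ℕ}

/-- A regular sequence of length `l` on `M` forces `Ext^i(M, R) = 0` for `i > n - l`. -/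
theorem extVanishes_of_isRegular
    (hn : ∀ (N : Type u) [AddCommGroup N] [Module R N] [Module.Finite R N]
      (i : ℕ), n < i → ExtVanishes R i N)
    (rs : List R) (hrs : ∀ r ∈ rs, r ∈ maximalIdeal R) [Module.Finite R M]
    (hreg : IsRegular M rs) (i : ℕ) (hi : n < i + rs.length) : ExtVanishes R i M := by
  induction rs generalizing M i with
  | nil => exact hn M i hi
  | cons r rs ih =>
    rw [isRegular_cons_iff] at hreg
    refine ExtVanishes.of_quotSMulTop (hrs r (by simp)) hreg.1
      (ih (fun s hs => hrs s (by simp [hs])) hreg.2 (i + 1) ?_)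
    rw [List.length_cons] at hi
    lia

/-- Given a maximal regular sequence of length `l` on `M`, `Ext^{n-l}(M, R) ≠ 0`. -/
theorem exists_not_extVanishes_of_isRegular
    (hn : ∀ (N : Type u) [AddCommGroup N] [Module R N] [Module.Finite R N]
      (i : ℕ), n < i → ExtVanishes R i N)
    (h0 : ∀ (N : Type u) [AddCommGroup N] [Module R N] [Module.Finite R N] [Nontrivial N],
      (∀ r ∈ maximalIdeal R, ¬ IsSMulRegular N r) → ¬ ExtVanishes R n N)
    (rs : List R) (hrs : ∀ r ∈ rs, r ∈ maximalIdeal R) [Module.Finite R M]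
    (hreg : IsRegular M rs)
    (hmax : ∀ r ∈ maximalIdeal R, ¬ IsRegular M (rs ++ [r])) :
    ∃ i, i + rs.length = n ∧ ¬ ExtVanishes R i M := by
  induction rs generalizing M with
  | nil =>
    have := hreg.nontrivial
    refine ⟨n, rfl, h0 M fun r hr h => hmax r hr ?_⟩
    rw [List.nil_append, isRegular_cons_iff]
    have := nontrivial_quotSMulTop_of_mem_maximalIdeal M hr
    exact ⟨h, .nil R _⟩
  | cons r rs ih =>
    have hreg' := (isRegular_cons_iff _ _ _).1 hreg
    have hr := hrs r (by simp)
    obtain ⟨i, hi, hv⟩ := ih (M := QuotSMulTop r M) (fun s hs => hrs s (by simp [hs])) hreg'.2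
      (fun s hs h => hmax s hs ((isRegular_cons_iff _ _ _).2 ⟨hreg'.1, h⟩))
    have hinj : Function.Injective (LinearMap.lsmul R M r) := hreg'.1
    have hvan := extVanishes_of_isRegular hn (r :: rs) hrs hreg
    rw [List.length_cons] at hvan ⊢
    rcases i with _ | j
    -- Degree `0` is impossible: `Hom(M/rM, R)` embeds in `Hom(M, R)`, which vanishes because `r ::
    -- rs` has length `n + 1`.
    · exact (hv (ExtVanishes.zero_right (Submodule.mkQ_surjective _)
        (hvan 0 (by lia)))).elim
    · refine ⟨j, by lia, fun h => hv ?_⟩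
      exact ExtVanishes.right hinj (exact_quotSMulTop r) (Submodule.mkQ_surjective _)
        h (hvan (j + 1) (by lia))

/-- Without a regular element in the annihilator `𝔪` of `R/𝔪`, there is a nonzero map from `R/𝔪` to
`M`. It is injective because `R/𝔪` is simple. -/
theorem exists_injective_residue [Module.Finite R M] [Nontrivial M]
    (h : ∀ r ∈ maximalIdeal R, ¬ IsSMulRegular M r) :
    ∃ φ : (R ⧸ maximalIdeal R) →ₗ[R] M, Function.Injective φ := by
  have h1 : ¬ Subsingleton ((R ⧸ maximalIdeal R) →ₗ[R] M) := by
    rw [IsSMulRegular.subsingleton_linearMap_iff, Ideal.annihilator_quotient]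
    rintro ⟨r, hr, hr'⟩
    exact h r hr hr'
  rw [not_subsingleton_iff_nontrivial] at h1
  obtain ⟨φ, hφ⟩ := exists_ne (0 : (R ⧸ maximalIdeal R) →ₗ[R] M)
  have : IsSimpleModule R (R ⧸ maximalIdeal R) :=
    isSimpleModule_iff_quot_maximal.2 ⟨_, inferInstance, ⟨.refl R _⟩⟩
  exact ⟨φ, LinearMap.injective_of_ne_zero hφ⟩

/-- If `Ext^{n+1}(-, R) = 0` and `Ext^n(R/𝔪, R) = 0` then `Ext^n(-, R) = 0`. -/
theorem extVanishes_of_extVanishes_residue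
    (hn : ∀ (N : Type u) [AddCommGroup N] [Module R N] [Module.Finite R N],
      ExtVanishes R (n + 1) N)
    (hk : ExtVanishes R n (R ⧸ maximalIdeal R)) [hM : Module.Finite R M] : ExtVanishes R n M := by
  induction hM using IsNoetherianRing.induction_on_isQuotientEquivQuotientPrime R with
  | subsingleton N =>
    exact IsRetract.extVanishes (B := R ⧸ maximalIdeal R) ⟨0, 0, Subsingleton.elim _ _⟩ hk
  | quotient N p e =>
    refine ExtVanishes.congr e.symm ?_
    by_cases hp : p.asIdeal = maximalIdeal R
    · rw [hp]
      exact hk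
    -- For a prime `p ≠ 𝔪`, any `x` in `𝔪` outside `p` is regular on `R/p`, so vanishing of
    -- `Ext^{n+1}` descends to `Ext^n`.
    obtain ⟨x, hx, hxp⟩ := SetLike.exists_of_lt
      (lt_of_le_of_ne (le_maximalIdeal p.isPrime.ne_top) hp)
    refine ExtVanishes.of_quotSMulTop hx ?_ (hn _)
    rw [isSMulRegular_iff_right_eq_zero_of_smul]
    intro y hy
    obtain ⟨y, rfl⟩ := Ideal.Quotient.mk_surjective y
    rw [Algebra.smul_def, Ideal.Quotient.algebraMap_eq, ← map_mul,
      Ideal.Quotient.eq_zero_iff_mem] at hy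
    exact Ideal.Quotient.eq_zero_iff_mem.2 ((p.isPrime.mem_or_mem hy).resolve_left hxp)
  | exact N₁ N₂ N₃ f g hf hg hfg h₁ h₃ => exact ExtVanishes.middle hf hfg hg h₁ h₃

end Local

section Gorenstein

variable (R : Type u) [CommRing R] [CMRad.IsGorensteinLocalRing R]

theorem exists_extVanishes_of_le : ∃ n : ℕ, ∀ (N : Type u) [AddCommGroup N] [Module R N] (i : ℕ),
    n ≤ i → ExtVanishes R i N := by
  obtain ⟨n, hn⟩ := (injectiveDimension_ne_top_iff _).1
    (CMRad.IsGorensteinLocalRing.injectiveDimension_ne_top (R := R))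
  have : HasInjectiveDimensionLT (ModuleCat.of R R) (n + 1) := hn
  exact ⟨n + 1, fun N _ _ i hi =>
    HasInjectiveDimensionLT.subsingleton (ModuleCat.of R R) (n + 1) i hi (ModuleCat.of R N)⟩

/-- The injective dimension `n` of `R` is characterised by `Ext^i(-, R) = 0` for `i > n` and
`Ext^n(N, R) ≠ 0` for all nonzero modules `N` of depth zero. -/
theorem exists_injective_dimension : ∃ n : ℕ,
    (∀ (N : Type u) [AddCommGroup N] [Module R N] [Module.Finite R N] (i : ℕ),
      n < i → ExtVanishes R i N) ∧
    (∀ (N : Type u) [AddCommGroup N] [Module R N] [Module.Finite R N] [Nontrivial N],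
      (∀ r ∈ maximalIdeal R, ¬ IsSMulRegular N r) → ¬ ExtVanishes R n N) := by
  classical
  have hfin : ∃ n : ℕ, ∀ (N : Type u) [AddCommGroup N] [Module R N] [Module.Finite R N] (i : ℕ),
      n ≤ i → ExtVanishes R i N := by
    obtain ⟨n, hn⟩ := exists_extVanishes_of_le R
    exact ⟨n, fun N _ _ _ i hi => hn N i hi⟩
  have hspec := Nat.find_spec hfin
  have hmin := fun {m : ℕ} => Nat.find_min hfin (m := m)
  obtain h | ⟨n, h⟩ : Nat.find hfin = 0 ∨ ∃ n, Nat.find hfin = n + 1 := by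
    cases Nat.find hfin <;> simp
  · have := hspec R 0 (by lia)
    rw [extVanishes_zero_iff] at this
    have h1 := LinearMap.congr_fun (Subsingleton.elim (LinearMap.id : R →ₗ[R] R) 0) 1
    exact (one_ne_zero h1).elim
  rw [h] at hspec hmin
  refine ⟨n, fun N _ _ _ i hi => hspec N i hi, fun N _ _ _ _ hN hv => ?_⟩
  obtain ⟨φ, hφ⟩ := exists_injective_residue hN
  -- `R/𝔪` embeds in `N`, so vanishing of `Ext^n` passes from `N` to `R/𝔪`, hence to all finite
  -- modules, against the minimality of `n + 1`.
  have hk : ExtVanishes R n (R ⧸ maximalIdeal R) :=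
    ExtVanishes.left hφ φ.exact_map_mkQ_range (Submodule.mkQ_surjective _) hv
      (hspec _ (n + 1) le_rfl)
  refine hmin (Nat.lt_succ_self n) fun N _ _ _ i hi => ?_
  rcases hi.eq_or_lt with rfl | hi
  · exact extVanishes_of_extVanishes_residue (fun N _ _ _ => hspec N _ le_rfl) hk
  · exact hspec N i hi

end Gorenstein

section Depth

variable {R : Type u} [CommRing R] [IsLocalRing R] [IsNoetherianRing R] {M : Type u}
  [AddCommGroup M] [Module R M] [Module.Finite R M]

/-- A regular sequence lowers the dimension of the support by its length, and the final quotient is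
nonzero, so its support has dimension at least `0`. -/
theorem length_le_ringKrullDim {rs : List R} (hreg : IsRegular M rs) :
    (rs.length : WithBot ℕ∞) ≤ ringKrullDim R := by
  have h := supportDim_add_length_eq_supportDim_of_isRegular rs hreg
  refine le_trans ?_ (supportDim_le_ringKrullDim R M)
  rw [← h]
  have := hreg.quot_ofList_smul_nontrivial ⊤
  have h0 : 0 ≤ supportDim R (M ⧸ Ideal.ofList rs • (⊤ : Submodule R M)) := by
    have := supportDim_ne_bot_of_nontrivial R (M ⧸ Ideal.ofList rs • (⊤ : Submodule R M))
    revert this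
    generalize supportDim R (M ⧸ Ideal.ofList rs • (⊤ : Submodule R M)) = d
    intro hd
    obtain ⟨e, rfl⟩ := WithBot.ne_bot_iff_exists.1 hd
    exact WithBot.coe_le_coe.2 zero_le
  exact le_add_of_nonneg_left h0

theorem exists_ringKrullDim_eq (R : Type u) [CommRing R] [IsLocalRing R] [IsNoetherianRing R] :
    ∃ d : ℕ, ringKrullDim R = d := by
  have h1 := ringKrullDim_ne_top (R := R)
  have h2 := ringKrullDim_ne_bot (R := R)
  obtain ⟨e, he⟩ := WithBot.ne_bot_iff_exists.1 h2
  rw [← he] at h1 ⊢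
  have h3 : e ≠ ⊤ := fun h => h1 (by rw [h]; rfl)
  obtain ⟨d, rfl⟩ := ENat.ne_top_iff_exists.1 h3
  exact ⟨d, rfl⟩

/-- The Krull dimension bounds the lengths, so the supremum defining the depth is attained. -/
theorem exists_maximal_regular_sequence [Nontrivial M] :
    ∃ rs : List R, (∀ r ∈ rs, r ∈ maximalIdeal R) ∧ IsRegular M rs ∧
      (∀ r ∈ maximalIdeal R, ¬ IsRegular M (rs ++ [r])) ∧ CMRad.depth R M = rs.length := by
  obtain ⟨d, hd⟩ := exists_ringKrullDim_eq R
  let S : Set ℕ := {l | ∃ rs : List R, (∀ r ∈ rs, r ∈ maximalIdeal R) ∧ IsRegular M rs ∧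
    rs.length = l}
  have hS : S.Nonempty := ⟨0, [], by simp, .nil R M, rfl⟩
  have hb : BddAbove S := by
    refine ⟨d, ?_⟩
    rintro _ ⟨rs, -, hrs, rfl⟩
    have := length_le_ringKrullDim hrs
    rw [hd] at this
    exact_mod_cast this
  obtain ⟨rs, hrs, hreg, hl⟩ := Nat.sSup_mem hS hb
  have hle : ∀ rs' : List R, (∀ r ∈ rs', r ∈ maximalIdeal R) → IsRegular M rs' →
      rs'.length ≤ rs.length := by
    intro rs' h h'
    rw [hl]
    exact le_csSup hb ⟨rs', h, h', rfl⟩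
  refine ⟨rs, hrs, hreg, fun r hr h => ?_, le_antisymm ?_ ?_⟩
  · have := hle (rs ++ [r]) (by simpa using fun a ha => ha.elim (hrs a) (fun h => h ▸ hr)) h
    simp at this
  · exact iSup₂_le fun rs' h => by exact_mod_cast hle rs' h.1 h.2
  · exact le_iSup₂_of_le rs ⟨hrs, hreg⟩ le_rfl

theorem depth_le_ringKrullDim [Nontrivial M] :
    (CMRad.depth R M : WithBot ℕ∞) ≤ ringKrullDim R := by
  obtain ⟨rs, -, hreg, -, h⟩ := exists_maximal_regular_sequence (R := R) (M := M)
  rw [h]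
  exact length_le_ringKrullDim hreg

end Depth

section CohenMacaulay

variable {R : Type u} [CommRing R] [CMRad.IsGorensteinLocalRing R]

/-- `Ext^i(M, R) = 0` for all `i > 0`. -/
def IsExtAcyclic (R : Type u) [CommRing R] (M : Type u) [AddCommGroup M] [Module R M] : Prop :=
  ∀ i, ExtVanishes R (i + 1) M

/-- The Auslander-Buchsbaum formula for the grade of `R`: the depth of `M` and the largest `i`
with `Ext^i(M, R) ≠ 0` add up to the injective dimension of `R`. -/
theorem exists_depth_add_eq : ∃ n : ℕ, ∀ (M : Type u) [AddCommGroup M] [Module R M]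
    [Module.Finite R M] [Nontrivial M], ∃ t i : ℕ, CMRad.depth R M = t ∧ i + t = n ∧
      ¬ ExtVanishes R i M ∧ ∀ j, i < j → ExtVanishes R j M := by
  obtain ⟨n, hn, h0⟩ := exists_injective_dimension R
  refine ⟨n, fun M _ _ _ _ => ?_⟩
  obtain ⟨rs, hrs, hreg, hmax, hd⟩ := exists_maximal_regular_sequence (R := R) (M := M)
  obtain ⟨i, hi, hv⟩ := exists_not_extVanishes_of_isRegular hn h0 rs hrs hreg hmax
  exact ⟨rs.length, i, hd, hi, hv, fun j hj => extVanishes_of_isRegular hn rs hrs hreg j (by lia)⟩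

/-- Over a Gorenstein local ring which has a nonzero maximal Cohen-Macaulay module, the maximal
Cohen-Macaulay modules are the modules `M` with `Ext^i(M, R) = 0` for all `i > 0`. -/
theorem cm_iff_isExtAcyclic {M₀ : FGModuleCat.{u} R} (h₀ : CMRad.CM R M₀) (h₀' : Nontrivial M₀)
    (M : FGModuleCat.{u} R) : CMRad.CM R M ↔ IsExtAcyclic R M := by
  obtain ⟨n, hn⟩ := exists_depth_add_eq (R := R)
  obtain ⟨d, hd⟩ := exists_ringKrullDim_eq R
  -- `R` has no higher `Ext` into itself, so the formula gives `n = depth R ≤ dim R`.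
  have hle : n ≤ d := by
    obtain ⟨t, i, ht, hi, hv, -⟩ := hn R
    have h1 : (CMRad.depth R R : WithBot ℕ∞) ≤ _ := depth_le_ringKrullDim (R := R) (M := R)
    rw [ht, hd] at h1
    rcases i with _ | i
    · rw [← hi, zero_add]
      exact_mod_cast h1
    · exact (hv (extVanishes_succ_of_projective i)).elim
  -- The nonzero module `M₀` has depth `d`, and depths are at most `n`. This takes the place of the
  -- theorem that Gorenstein rings are Cohen–Macaulay.
  have hdn : n = d := by
    obtain ⟨t, i, ht, hi, -⟩ := hn M₀
    have h1 := h₀.resolve_left (not_subsingleton_iff_nontrivial.2 h₀')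
    rw [ht, hd] at h1
    have : t = d := by exact_mod_cast h1
    lia
  rcases subsingleton_or_nontrivial M with h | h
  · refine ⟨fun _ i => ?_, fun _ => .inl h⟩
    exact IsRetract.extVanishes (B := R) ⟨0, 0, Subsingleton.elim _ _⟩
      (extVanishes_succ_of_projective i)
  obtain ⟨t, i, ht, hi, hv, hj⟩ := hn M
  have h1 : CMRad.CM R M ↔ t = d := by
    rw [CMRad.CM, or_iff_right (not_subsingleton_iff_nontrivial.2 h), ht, hd]
    norm_cast
  rw [h1]
  constructor
  · intro h k
    exact hj _ (by lia)
  · intro h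
    rcases i with _ | i
    · lia
    · exact (hv (h i)).elim

end CohenMacaulay

end Module

end

/-! ### Duality for `Ext`-acyclic modules and cosyzygies. -/

section

open IsLocalRing

namespace Module

section

variable {R : Type u} [CommRing R] {A B C : Type u} [AddCommGroup A] [Module R A]
  [AddCommGroup B] [Module R B] [AddCommGroup C] [Module R C]

theorem IsRetract.isExtAcyclic (h : IsRetract R A B) (hB : IsExtAcyclic R B) :
    IsExtAcyclic R A := fun i => h.extVanishes (hB i)

theorem isExtAcyclic_of_projective [Module.Projective R A] : IsExtAcyclic R A :=
  fun i => extVanishes_succ_of_projective i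

variable {f : A →ₗ[R] B} {g : B →ₗ[R] C}
  (hf : Function.Injective f) (hfg : Function.Exact f g) (hg : Function.Surjective g)
include hf hfg hg

theorem IsExtAcyclic.left (hB : IsExtAcyclic R B) (hC : IsExtAcyclic R C) : IsExtAcyclic R A :=
  fun i => ExtVanishes.left hf hfg hg (hB i) (hC (i + 1))

theorem dualMap_shortExact (hC : ExtVanishes R 1 C) :
    Function.Injective g.dualMap ∧ Function.Exact g.dualMap f.dualMap ∧
      Function.Surjective f.dualMap := by
  refine ⟨LinearMap.dualMap_injective_of_surjective hg, fun φ => ⟨fun h => ?_, ?_⟩, fun φ =>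
    ExtVanishes.exists_extension hf hfg hg hC φ⟩
  · have hle : LinearMap.ker g ≤ LinearMap.ker φ := by
      intro b hb
      obtain ⟨a, rfl⟩ := (hfg b).1 hb
      exact LinearMap.congr_fun h a
    refine ⟨(LinearMap.ker g).liftQ φ hle ∘ₗ (g.quotKerEquivOfSurjective hg).symm, ?_⟩
    ext b
    have : (g.quotKerEquivOfSurjective hg).symm (g b) = (LinearMap.ker g).mkQ b := by
      rw [LinearEquiv.symm_apply_eq]
      rfl
    simp [this]
  · rintro ⟨ψ, rfl⟩
    ext a
    simp [hfg.apply_apply_eq_zero a]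

end

section

variable {R : Type u} [CommRing R] {M : Type u} [AddCommGroup M] [Module R M]
  [Module.Finite R M]

theorem exists_shortExact (M : Type u) [AddCommGroup M] [Module R M] [Module.Finite R M] :
    ∃ (k : ℕ) (K : Submodule R (Fin k → R)) (g : (Fin k → R) →ₗ[R] M),
      Function.Surjective g ∧ Function.Exact K.subtype g := by
  obtain ⟨k, g, hg⟩ := Module.Finite.exists_fin' R M
  refine ⟨k, LinearMap.ker g, g, hg, fun x => ?_⟩
  simp

/-- Dimension shifting: the dual of `0 → K → F → M → 0` is exact and reduces `Ext^{i+1}(M*, R)` to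
`Ext^{i+2}(K*, R)`. Since `K` is again acyclic, this can be repeated until the degree reaches `n`.
-/
theorem IsExtAcyclic.extVanishes_dual [IsNoetherianRing R] {n : ℕ}
    (hn : ∀ (N : Type u) [AddCommGroup N] [Module R N] (i : ℕ), n ≤ i → ExtVanishes R i N)
    (j : ℕ) : ∀ (M : Type u) [AddCommGroup M] [Module R M] [Module.Finite R M]
      (_ : IsExtAcyclic R M) (i : ℕ), n ≤ i + 1 + j → ExtVanishes R (i + 1) (Module.Dual R M) := by
  induction j with
  | zero => exact fun M _ _ _ _ i hi => hn _ _ hi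
  | succ j ih =>
    intro M _ _ _ hM i hi
    obtain ⟨k, K, g, hg, hK⟩ := exists_shortExact (R := R) M
    have hKa := IsExtAcyclic.left K.injective_subtype hK hg isExtAcyclic_of_projective hM
    obtain ⟨h1, h2, h3⟩ := dualMap_shortExact K.injective_subtype hK hg (hM 0)
    exact ExtVanishes.left h1 h2 h3 (extVanishes_succ_of_projective i)
      (ih K hKa (i + 1) (by lia))

variable [CMRad.IsGorensteinLocalRing R]

theorem IsExtAcyclic.dual (hM : IsExtAcyclic R M) : IsExtAcyclic R (Module.Dual R M) := by
  obtain ⟨n, hn⟩ := exists_extVanishes_of_le R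
  exact fun i => IsExtAcyclic.extVanishes_dual hn n M hM i (by lia)

/-- The cokernel of `M* → F*` is the acyclic `K*`, so a functional on `M*` extends to `F*`, where it
is an evaluation because `F` is free. -/
theorem IsExtAcyclic.dual_eval_surjective (hM : IsExtAcyclic R M) :
    Function.Surjective (Module.Dual.eval R M) := by
  intro φ
  obtain ⟨k, K, g, hg, hK⟩ := exists_shortExact (R := R) M
  have hKa := IsExtAcyclic.left K.injective_subtype hK hg isExtAcyclic_of_projective hM
  obtain ⟨h1, h2, h3⟩ := dualMap_shortExact K.injective_subtype hK hg (hM 0)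
  obtain ⟨ψ, rfl⟩ := ExtVanishes.exists_extension h1 h2 h3 (hKa.dual 0) φ
  obtain ⟨x, rfl⟩ := (Module.bijective_dual_eval R (Fin k → R)).2 ψ
  exact ⟨g x, rfl⟩

/-- If `x = g y` dies in `M**`, then `y` comes from `K**`, hence from `K` by surjectivity of `K →
K**`, and so `x = 0`. -/
theorem IsExtAcyclic.dual_eval_injective (hM : IsExtAcyclic R M) :
    Function.Injective (Module.Dual.eval R M) := by
  rw [injective_iff_map_eq_zero]
  intro x hx
  obtain ⟨k, K, g, hg, hK⟩ := exists_shortExact (R := R) M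
  have hKa := IsExtAcyclic.left K.injective_subtype hK hg isExtAcyclic_of_projective hM
  obtain ⟨h1, h2, h3⟩ := dualMap_shortExact K.injective_subtype hK hg (hM 0)
  obtain ⟨y, rfl⟩ := hg x
  have := (dualMap_shortExact h1 h2 h3 (hKa.dual 0)).2.1 (Module.Dual.eval R _ y)
  obtain ⟨ψ, hψ⟩ := this.1 hx
  obtain ⟨z, rfl⟩ := hKa.dual_eval_surjective ψ
  have hyz : (z : Fin k → R) = y := (Module.bijective_dual_eval R (Fin k → R)).1 hψ
  rw [← hyz]
  exact hK.apply_apply_eq_zero z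

/-- Over a Gorenstein local ring, an `Ext`-acyclic module embeds in a free module with
`Ext`-acyclic cokernel. -/
theorem IsExtAcyclic.exists_cosyzygy (hM : IsExtAcyclic R M) :
    ∃ (k : ℕ) (f : M →ₗ[R] (Fin k → R)), Function.Injective f ∧
      IsExtAcyclic R ((Fin k → R) ⧸ LinearMap.range f) := by
  -- The coordinates of the embedding are generators of `M*`, so every functional on `M` extends
  -- along it. This gives both injectivity, as `M → M**` is injective, and `Ext^1 = 0` for the
  -- cokernel.
  obtain ⟨k, p, hp⟩ := Module.Finite.exists_fin' R (Module.Dual R M)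
  let f : M →ₗ[R] (Fin k → R) := LinearMap.pi fun i => p (Pi.single i 1)
  have hext : ∀ φ : M →ₗ[R] R, ∃ ψ : (Fin k → R) →ₗ[R] R, ψ ∘ₗ f = φ := by
    intro φ
    obtain ⟨c, rfl⟩ := hp φ
    refine ⟨∑ i, c i • LinearMap.proj i, ?_⟩
    have hc : p c = ∑ i, c i • p (Pi.single i 1) := by
      conv_lhs => rw [pi_eq_sum_univ' c]
      rw [map_sum]
      refine Finset.sum_congr rfl fun i _ => ?_
      rw [map_smul]
    rw [hc]
    ext x
    simp [f]
  have hinj : Function.Injective f := by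
    rw [injective_iff_map_eq_zero]
    intro x hx
    apply hM.dual_eval_injective
    rw [map_zero]
    ext φ
    obtain ⟨ψ, rfl⟩ := hext φ
    simp [hx]
  refine ⟨k, f, hinj, fun i => ?_⟩
  rcases i with _ | i
  · exact extVanishes_one_of_exists_extension hinj f.exact_map_mkQ_range
      (Submodule.mkQ_surjective _) (extVanishes_succ_of_projective 0) hext
  · exact ExtVanishes.right hinj f.exact_map_mkQ_range (Submodule.mkQ_surjective _) (hM i)
      (extVanishes_succ_of_projective _)

end

section

variable {R : Type u} [CommRing R] [IsLocalRing R] {M : Type u} [AddCommGroup M] [Module R M]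

theorem mem_maximalIdeal_smul_top_of_forall {k : ℕ} {x : Fin k → R}
    (hx : ∀ i, x i ∈ maximalIdeal R) : x ∈ maximalIdeal R • (⊤ : Submodule R (Fin k → R)) := by
  rw [pi_eq_sum_univ' x]
  exact Submodule.sum_mem _ fun i _ => Submodule.smul_mem_smul (hx i) trivial

/-- A linear map from a non-free module with local endomorphism ring to a free module has image
in `𝔪 R^k`. -/
theorem range_le_maximalIdeal_smul [IsLocalRing (Module.End R M)] (hM : ¬ Nonempty (M ≃ₗ[R] R))
    {k : ℕ} (f : M →ₗ[R] (Fin k → R)) :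
    LinearMap.range f ≤ maximalIdeal R • (⊤ : Submodule R (Fin k → R)) := by
  rintro _ ⟨x, rfl⟩
  refine mem_maximalIdeal_smul_top_of_forall fun i => ?_
  by_contra h
  rw [mem_maximalIdeal, mem_nonunits_iff, not_not] at h
  obtain ⟨u, hu⟩ := h
  apply hM
  have : IsRetract R R M := by
    refine ⟨LinearMap.toSpanSingleton R M ((↑u⁻¹ : R) • x), LinearMap.proj i ∘ₗ f, ?_⟩
    ext
    simp [← hu]
  obtain ⟨e⟩ := this.equiv_of_isLocalRing
  exact ⟨e.symm⟩

end

end Module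

end

/-! ### Minimal free covers and syzygies. -/

section

open IsLocalRing

namespace Module

/-- `K` is a first syzygy of `M`: the kernel of a minimal free cover of `M`. -/
def IsSyzygyOf (R : Type u) [CommRing R] [IsLocalRing R] (M K : Type u) [AddCommGroup M]
    [Module R M] [AddCommGroup K] [Module R K] : Prop :=
  ∃ (F : ModuleCat.{u} R) (f : K →ₗ[R] F) (g : F →ₗ[R] M), Module.Free R F ∧ Module.Finite R F ∧
    Function.Injective f ∧ Function.Exact f g ∧ Function.Surjective g ∧
    LinearMap.range f ≤ maximalIdeal R • (⊤ : Submodule R F)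

section

variable {R : Type u} [CommRing R] [IsLocalRing R] {M M' K K' F F' : Type u}
  [AddCommGroup M] [Module R M] [AddCommGroup M'] [Module R M'] [AddCommGroup K] [Module R K]
  [AddCommGroup K'] [Module R K'] [AddCommGroup F] [Module R F] [AddCommGroup F'] [Module R F']

theorem IsSyzygyOf.exists_fin (h : IsSyzygyOf R M K) :
    ∃ (k : ℕ) (f : K →ₗ[R] (Fin k → R)) (g : (Fin k → R) →ₗ[R] M),
      Function.Injective f ∧ Function.Exact f g ∧ Function.Surjective g ∧
      LinearMap.range f ≤ maximalIdeal R • (⊤ : Submodule R (Fin k → R)) := by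
  obtain ⟨F, f, g, _, _, hf, hfg, hg, hm⟩ := h
  let e : F ≃ₗ[R] (Fin (finrank R F) → R) := (Module.finBasis R F).equivFun
  refine ⟨finrank R F, e.toLinearMap ∘ₗ f, g ∘ₗ e.symm.toLinearMap, e.injective.comp hf, ?_,
    hg.comp e.symm.surjective, ?_⟩
  · intro x
    rw [LinearMap.comp_apply, LinearEquiv.coe_coe, hfg (e.symm x)]
    simp [LinearEquiv.eq_symm_apply]
  · rw [LinearMap.range_comp]
    refine (Submodule.map_mono hm).trans ?_
    rw [Submodule.map_smul'']
    exact smul_mono_right _ le_top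

theorem isFirstSyzygy_iff (M N : FGModuleCat.{u} R) :
    CMRad.IsFirstSyzygy M N ↔ IsSyzygyOf R M N := by
  refine ⟨fun ⟨k, f, g, h⟩ => ⟨ModuleCat.of R (Fin k → R), f, g, ?_, ?_, h⟩, fun h => h.exists_fin⟩
  · exact inferInstanceAs (Module.Free R (Fin k → R))
  · exact inferInstanceAs (Module.Finite R (Fin k → R))

/-- Nakayama: minimality puts the kernel of `g` inside `𝔪F`, so `a` is surjective modulo `𝔪F`. A
surjective endomorphism of a finite module is bijective. -/
theorem bijective_of_lift [Module.Finite R F] {f : K →ₗ[R] F} {g : F →ₗ[R] M}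
    (hfg : Function.Exact f g) (hg : Function.Surjective g)
    (hm : LinearMap.range f ≤ maximalIdeal R • (⊤ : Submodule R F)) (a : F →ₗ[R] F)
    {γ : M →ₗ[R] M} (hγ : Function.Surjective γ) (ha : g ∘ₗ a = γ ∘ₗ g) :
    Function.Bijective a := by
  suffices h : Function.Surjective a from
    ⟨OrzechProperty.injective_of_surjective_endomorphism a h, h⟩
  rw [← LinearMap.range_eq_top]
  refine eq_top_iff.2 (Submodule.le_of_le_smul_of_le_jacobson_bot (I := maximalIdeal R)
    Module.Finite.fg_top (IsLocalRing.maximalIdeal_le_jacobson _) fun x _ => ?_)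
  obtain ⟨y, hy⟩ := (hγ.comp hg) (g x)
  have h0 : g (x - a y) = 0 := by
    rw [map_sub, ← hy]
    exact sub_eq_zero.2 (LinearMap.congr_fun ha y).symm
  obtain ⟨z, hz⟩ := (hfg _).1 h0
  rw [← sub_add_cancel x (a y), ← hz]
  exact add_mem (Submodule.mem_sup_right (hm ⟨z, rfl⟩)) (Submodule.mem_sup_left ⟨y, rfl⟩)

/-- Lifts of `e` and of its inverse to the free covers have bijective composites, so they identify
the covers and with them the kernels. -/
theorem IsSyzygyOf.equiv (h : IsSyzygyOf R M K) (h' : IsSyzygyOf R M' K') (e : M ≃ₗ[R] M') :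
    Nonempty (K ≃ₗ[R] K') := by
  obtain ⟨F, f, g, _, _, hf, hfg, hg, hm⟩ := h
  obtain ⟨F', f', g', _, _, hf', hfg', hg', hm'⟩ := h'
  obtain ⟨a, ha⟩ := Module.projective_lifting_property g' (e.toLinearMap ∘ₗ g) hg'
  obtain ⟨b, hb⟩ := Module.projective_lifting_property g (e.symm.toLinearMap ∘ₗ g') hg
  have hba : Function.Bijective (b ∘ₗ a) :=
    bijective_of_lift hfg hg hm _ (γ := LinearMap.id) Function.surjective_id (by
      rw [← LinearMap.comp_assoc, hb, LinearMap.comp_assoc, ha, ← LinearMap.comp_assoc]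
      simp)
  have hab : Function.Bijective (a ∘ₗ b) :=
    bijective_of_lift hfg' hg' hm' _ (γ := LinearMap.id) Function.surjective_id (by
      rw [← LinearMap.comp_assoc, ha, LinearMap.comp_assoc, hb, ← LinearMap.comp_assoc]
      simp)
  let a' : F ≃ₗ[R] F' := .ofBijective a
    ⟨Function.Injective.of_comp (f := b) hba.1, Function.Surjective.of_comp (g := b) hab.2⟩
  have hmap : Submodule.map a'.toLinearMap (LinearMap.ker g) = LinearMap.ker g' := by
    ext y
    obtain ⟨x, rfl⟩ := a'.surjective y
    have h1 : g' (a' x) = e (g x) := LinearMap.congr_fun ha x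
    simp [h1]
  have hk : LinearMap.range f = LinearMap.ker g := hfg.linearMap_ker_eq.symm
  have hk' : LinearMap.ker g' = LinearMap.range f' := hfg'.linearMap_ker_eq
  exact ⟨(LinearEquiv.ofInjective f hf).trans ((LinearEquiv.ofEq _ _ hk).trans
    ((a'.ofSubmodules _ _ hmap).trans ((LinearEquiv.ofEq _ _ hk').trans
      (LinearEquiv.ofInjective f' hf').symm)))⟩

theorem IsSyzygyOf.congr (h : IsSyzygyOf R M K) (e : M ≃ₗ[R] M') (e' : K ≃ₗ[R] K') :
    IsSyzygyOf R M' K' := by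
  obtain ⟨F, f, g, hF, hF', hf, hfg, hg, hm⟩ := h
  refine ⟨F, f ∘ₗ e'.symm.toLinearMap, e.toLinearMap ∘ₗ g, hF, hF', hf.comp e'.symm.injective, ?_,
    e.surjective.comp hg, ?_⟩
  · intro x
    rw [LinearMap.comp_apply, LinearEquiv.coe_coe, LinearEquiv.map_eq_zero_iff, hfg x]
    constructor
    · rintro ⟨y, rfl⟩
      exact ⟨e' y, by simp⟩
    · rintro ⟨y, rfl⟩
      exact ⟨e'.symm y, rfl⟩
  · exact (LinearMap.range_comp_le_range _ _).trans hm

theorem isSyzygyOf_self_punit : IsSyzygyOf R R PUnit.{u + 1} :=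
  ⟨ModuleCat.of R R, 0, LinearMap.id, inferInstanceAs (Module.Free R R),
    inferInstanceAs (Module.Finite R R), Function.injective_of_subsingleton _,
    fun x => by simp [eq_comm], Function.surjective_id, by simp⟩

/-- A cover of least rank is minimal: a relation with a unit coordinate would make a generator
superfluous. -/
theorem exists_isSyzygyOf (M : Type u) [AddCommGroup M] [Module R M] [Module.Finite R M] :
    ∃ K : ModuleCat.{u} R, IsSyzygyOf R M K := by
  classical
  have hex : ∃ k : ℕ, ∃ g : (Fin k → R) →ₗ[R] M, Function.Surjective g :=
    Module.Finite.exists_fin' R M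
  obtain ⟨g, hg⟩ := Nat.find_spec hex
  have hmin := fun {m : ℕ} => Nat.find_min hex (m := m)
  revert g hmin
  generalize Nat.find hex = k
  intro g hg hmin
  refine ⟨ModuleCat.of R (LinearMap.ker g), ModuleCat.of R (Fin k → R), (LinearMap.ker g).subtype,
    g, inferInstanceAs (Module.Free R (Fin k → R)), inferInstanceAs (Module.Finite R (Fin k → R)),
    (LinearMap.ker g).injective_subtype, fun x => by simp, hg, ?_⟩
  rintro _ ⟨⟨v, hv⟩, rfl⟩
  refine mem_maximalIdeal_smul_top_of_forall fun i => ?_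
  change v i ∈ _
  by_contra h
  rw [mem_maximalIdeal, mem_nonunits_iff, not_not] at h
  obtain ⟨w, hw⟩ := h
  rcases k with _ | k
  · exact i.elim0
  refine hmin (Nat.lt_succ_self k) ?_
  -- `j` inserts a zero in position `i`.
  let j : (Fin k → R) →ₗ[R] (Fin (k + 1) → R) :=
    LinearMap.pi fun l => if h : ∃ t, i.succAbove t = l then LinearMap.proj h.choose else 0
  have hj : ∀ x : Fin (k + 1) → R, x i = 0 → j (fun t => x (i.succAbove t)) = x := by
    intro x hx
    ext l
    simp only [j, LinearMap.pi_apply]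
    split_ifs with h
    · simp [h.choose_spec]
    · have : l = i := by
        by_contra hl
        exact h (Fin.exists_succAbove_eq hl)
      rw [this, hx]
      rfl
  refine ⟨g ∘ₗ j, fun y => ?_⟩
  obtain ⟨x, rfl⟩ := hg y
  -- Subtracting this multiple of the relation `v` clears the coordinate `i` and leaves the image
  -- under `g` unchanged.
  refine ⟨fun t => (x - (x i * ↑w⁻¹) • v) (i.succAbove t), ?_⟩
  rw [LinearMap.comp_apply, hj _ (by simp [← hw]), map_sub, map_smul, LinearMap.mem_ker.1 hv,
    smul_zero, sub_zero]

theorem IsSyzygyOf.finite [IsNoetherianRing R] (h : IsSyzygyOf R M K) : Module.Finite R K := by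
  obtain ⟨F, f, g, hF, hF', hf, -⟩ := h
  exact Module.Finite.of_injective f hf

theorem IsSyzygyOf.pi {m : ℕ} {X Y : Fin m → Type u} [∀ i, AddCommGroup (X i)]
    [∀ i, Module R (X i)] [∀ i, AddCommGroup (Y i)] [∀ i, Module R (Y i)]
    (h : ∀ i, IsSyzygyOf R (X i) (Y i)) : IsSyzygyOf R (∀ i, X i) (∀ i, Y i) := by
  choose F f g hF hF' hf hfg hg hm using h
  refine ⟨ModuleCat.of R (∀ i, F i), LinearMap.piMap f, LinearMap.piMap g,
    inferInstanceAs (Module.Free R (∀ i, F i)), inferInstanceAs (Module.Finite R (∀ i, F i)),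
    Function.Injective.piMap hf, ?_, Function.Surjective.piMap hg, ?_⟩
  · intro x
    constructor
    · intro hx
      choose y hy using fun i => (hfg i (x i)).1 (congrFun hx i)
      exact ⟨y, funext hy⟩
    · rintro ⟨y, rfl⟩
      funext i
      exact (hfg i).apply_apply_eq_zero (y i)
  · rintro _ ⟨y, rfl⟩
    have h1 : LinearMap.piMap f y = ∑ i, LinearMap.single R (fun i => F i) i (f i (y i)) := by
      simp only [LinearMap.coe_single]
      exact (Finset.univ_sum_single (fun i => f i (y i))).symm
    rw [h1]
    refine Submodule.sum_mem _ fun i _ => ?_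
    have h2 := Submodule.mem_map_of_mem (f := LinearMap.single R (fun i => F i) i)
      (hm i ⟨y i, rfl⟩)
    rw [Submodule.map_smul''] at h2
    exact Submodule.smul_mono le_rfl le_top h2

/-- A unit on `M` lifts only to bijections of the minimal cover; a diagram chase then gives
bijectivity on the kernel. -/
theorem isUnit_of_isUnit_of_comp {f : K →ₗ[R] F} {g : F →ₗ[R] M} [Module.Finite R F]
    (hf : Function.Injective f) (hfg : Function.Exact f g) (hg : Function.Surjective g)
    (hm : LinearMap.range f ≤ maximalIdeal R • (⊤ : Submodule R F))
    {φ : Module.End R K} {a : Module.End R F} {γ : Module.End R M} (haf : a ∘ₗ f = f ∘ₗ φ)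
    (hga : g ∘ₗ a = γ ∘ₗ g) (hγ : IsUnit γ) : IsUnit φ := by
  rw [Module.End.isUnit_iff] at hγ ⊢
  have ha := bijective_of_lift hfg hg hm a hγ.2 hga
  have haf' : ∀ x, a (f x) = f (φ x) := LinearMap.congr_fun haf
  constructor
  · refine Function.Injective.of_comp (f := f) ?_
    have : f ∘ φ = a ∘ f := funext fun x => (haf' x).symm
    rw [this]
    exact ha.1.comp hf
  · intro y
    obtain ⟨x, hx⟩ := ha.2 (f y)
    have h1 : γ (g x) = 0 := by
      rw [← hfg.apply_apply_eq_zero y, ← hx]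
      exact (LinearMap.congr_fun hga x).symm
    obtain ⟨z, rfl⟩ := (hfg x).1 (hγ.1 (h1.trans (map_zero γ).symm))
    exact ⟨z, hf (by rw [← haf', hx])⟩

/-- The syzygy of a module `M` with local endomorphism ring has local endomorphism ring if
`Ext^1(M, R) = 0`. -/
theorem IsSyzygyOf.isLocalRing_end (h : IsSyzygyOf R M K) (hM : ExtVanishes R 1 M)
    [IsLocalRing (Module.End R M)] [Nontrivial K] : IsLocalRing (Module.End R K) := by
  obtain ⟨k, f, g, hf, hfg, hg, hm⟩ := h.exists_fin
  refine .of_isUnit_or_isUnit_one_sub_self fun φ => ?_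
  -- `Ext^1(M, R) = 0` extends `φ` coordinatewise to an endomorphism `a` of the cover, which induces
  -- `γ` on `M`. Units among `γ` and `1 - γ` then transfer to `φ` and `1 - φ`.
  choose ψ hψ using fun i =>
    ExtVanishes.exists_extension hf hfg hg hM (LinearMap.proj i ∘ₗ f ∘ₗ φ)
  let a : Module.End R (Fin k → R) := LinearMap.pi ψ
  have haf : a ∘ₗ f = f ∘ₗ φ := by
    ext x i
    exact LinearMap.congr_fun (hψ i) x
  have hle : LinearMap.ker g ≤ LinearMap.ker (g ∘ₗ a) := by
    intro x hx
    obtain ⟨y, rfl⟩ := (hfg x).1 hx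
    have : a (f y) = f (φ y) := LinearMap.congr_fun haf y
    simp [this, hfg.apply_apply_eq_zero]
  let γ : Module.End R M := (LinearMap.ker g).liftQ (g ∘ₗ a) hle ∘ₗ
    (g.quotKerEquivOfSurjective hg).symm.toLinearMap
  have hga : g ∘ₗ a = γ ∘ₗ g := by
    apply LinearMap.ext
    intro x
    have : (g.quotKerEquivOfSurjective hg).symm (g x) = (LinearMap.ker g).mkQ x := by
      rw [LinearEquiv.symm_apply_eq]
      rfl
    simp [γ, this]
  rcases IsLocalRing.isUnit_or_isUnit_one_sub γ with h | h
  · exact .inl (isUnit_of_isUnit_of_comp hf hfg hg hm haf hga h)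
  · refine .inr (isUnit_of_isUnit_of_comp (a := 1 - a) hf hfg hg hm ?_ ?_ h)
    · rw [LinearMap.sub_comp, LinearMap.comp_sub, haf]
      rfl
    · rw [LinearMap.sub_comp, LinearMap.comp_sub, hga]
      rfl

end

theorem IsRetract.finite {R : Type u} [CommRing R] {M N : Type u} [AddCommGroup M] [Module R M]
    [AddCommGroup N] [Module R N] [Module.Finite R N] (h : IsRetract R M N) :
    Module.Finite R M := by
  obtain ⟨i, p, hp⟩ := h
  exact Module.Finite.of_surjective p fun x => ⟨i x, LinearMap.congr_fun hp x⟩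

theorem IsRetract.nontrivial {R : Type u} [CommRing R] {M N : Type u} [AddCommGroup M] [Module R M]
    [AddCommGroup N] [Module R N] [Nontrivial M] (h : IsRetract R M N) : Nontrivial N := by
  obtain ⟨i, p, hp⟩ := h
  exact Function.Injective.nontrivial (f := i)
    (Function.LeftInverse.injective (g := p) (LinearMap.congr_fun hp))

section

variable {R : Type u} [CommRing R] [HenselianLocalRing R] [IsNoetherianRing R] {L N M : Type u}
  [AddCommGroup M] [Module R M] [AddCommGroup N] [Module R N] [AddCommGroup L] [Module R L]

/-- Every direct summand with local endomorphism ring of the syzygy of an `Ext`-acyclic module `L`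
is the syzygy of a non-free direct summand of `L` with local endomorphism ring. -/
theorem IsSyzygyOf.exists_retract [Module.Finite R L] (hL : IsExtAcyclic R L)
    (h : IsSyzygyOf R L N) [IsLocalRing (Module.End R M)] (hMN : IsRetract R M N) :
    ∃ L' : FGModuleCat.{u} R, IsRetract R L' L ∧ IsLocalRing (Module.End R L') ∧
      ¬ Nonempty (L' ≃ₗ[R] R) ∧ IsSyzygyOf R L' M := by
  obtain ⟨n, X, hX, ⟨e⟩⟩ := isSumOfIndecomposables_of_isNoetherian (R := R) (M := L)
  have hret : ∀ i, IsRetract R (X i) L := fun i => IsRetract.proj (fun i => X i) e i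
  have hfin : ∀ i, Module.Finite R (X i) := fun i => (hret i).finite
  have hloc : ∀ i, IsLocalRing (Module.End R (X i)) := fun i => (hX i).isLocalRing_end
  choose K hK using fun i => exists_isSyzygyOf (R := R) (X i)
  obtain ⟨e'⟩ := h.equiv (IsSyzygyOf.pi hK) e
  -- `N` is the sum of the syzygies `K i` of the indecomposable summands of `L`, so `M` is a summand
  -- of one `K i`. That `K i` has a local endomorphism ring, hence equals `M` up to isomorphism.
  obtain ⟨i, hi⟩ := IsRetract.exists_of_pi (fun i => K i) (hMN.trans (.of_equiv e'))
  have : Nontrivial M := nontrivial_of_isLocalRing_end (R := R)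
  have := hi.nontrivial
  have := (hK i).isLocalRing_end ((hret i).isExtAcyclic hL 0)
  obtain ⟨e''⟩ := hi.equiv_of_isLocalRing
  refine ⟨⟨X i, hfin i⟩, hret i, hloc i, ?_, (hK i).congr (.refl R _) e''.symm⟩
  -- If `X i` were free of rank one, its syzygy would be zero.
  rintro ⟨eR⟩
  obtain ⟨e₀⟩ := (hK i).equiv isSyzygyOf_self_punit eR
  exact not_subsingleton (K i) e₀.toEquiv.subsingleton

end

end Module

end

/-! ### Finiteness of the set of isomorphism classes, and the equivalence. -/

section

open IsLocalRing

/-- A set `T` on which `σ` is surjective and which consists of iterates of finitely many of its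
elements is finite. -/
theorem Set.Finite.of_iterate {α : Type*} (σ : α → α) {T B : Set α} (hB : B.Finite) (hBT : B ⊆ T)
    (hT : ∀ t ∈ T, ∃ b ∈ B, ∃ i : ℕ, t = σ^[i] b) (hσ : ∀ t ∈ T, ∃ t' ∈ T, t = σ t') :
    T.Finite := by
  have : Finite B := hB
  -- One step back under `σ`, then expressed by a point of `B`. The exponent `a + 1` is positive, so
  -- going back always costs at least one iteration.
  have hpre : ∀ b : B, ∃ (b' : B) (a : ℕ), (b : α) = σ^[a + 1] b' := by
    rintro ⟨b, hb⟩
    obtain ⟨t, ht, rfl⟩ := hσ b (hBT hb)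
    obtain ⟨b', hb', i, rfl⟩ := hT t ht
    exact ⟨⟨b', hb'⟩, i, (Function.iterate_succ_apply' σ i b').symm⟩
  choose φ a ha using hpre
  have hφ : ∀ (j : ℕ) (b : B), ∃ c, j ≤ c ∧ (b : α) = σ^[c] (φ^[j] b : B) := by
    intro j
    induction j with
    | zero => exact fun b => ⟨0, le_rfl, rfl⟩
    | succ j ih =>
      intro b
      obtain ⟨c, hc, h⟩ := ih (φ b)
      refine ⟨a b + 1 + c, by lia, ?_⟩
      rw [Function.iterate_succ_apply, Function.iterate_add_apply, ← h]
      exact ha b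
  have hper : ∀ b : B, ∃ p, 0 < p ∧ Function.IsPeriodicPt σ p (b : α) := by
    intro b
    -- The backward path from `b` repeats in the finite set `B`. A repeated point is periodic under
    -- `σ`, and `b` is one of its forward iterates.
    obtain ⟨m, m', hne, heq⟩ := Finite.exists_ne_map_eq_of_infinite fun m : ℕ => φ^[m] b
    wlog hlt : m < m' generalizing m m'
    · exact this m' m hne.symm heq.symm (by lia)
    obtain ⟨c, -, hc⟩ := hφ m b
    obtain ⟨p, hp, hp'⟩ := hφ (m' - m) (φ^[m] b)
    rw [← Function.iterate_add_apply, Nat.sub_add_cancel hlt.le, ← heq] at hp'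
    refine ⟨p, by lia, ?_⟩
    have h : Function.IsPeriodicPt σ p ((φ^[m] b : B) : α) := hp'.symm
    rw [hc]
    exact h.apply_iterate c
  choose p hp hp' using hper
  refine (Set.finite_iUnion fun b : B => (Set.finite_Iio (p b)).image fun i => σ^[i] b).subset ?_
  intro t ht
  obtain ⟨b, hb, i, rfl⟩ := hT t ht
  refine Set.mem_iUnion.2 ⟨⟨b, hb⟩, i % p ⟨b, hb⟩, Nat.mod_lt _ (hp _), ?_⟩
  exact (hp' ⟨b, hb⟩).iterate_mod_apply i

namespace Module

section

variable {R : Type u} [CommRing R] {M N : Type u} [AddCommGroup M] [Module R M] [AddCommGroup N]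
  [Module R N]

theorem isLocalRing_end_self (R : Type u) [CommRing R] [IsLocalRing R] :
    IsLocalRing (Module.End R R) := by
  refine .of_isUnit_or_isUnit_one_sub_self fun f => ?_
  have hf : f = algebraMap R (Module.End R R) (f 1) := by
    ext
    simp
  rw [hf, ← map_one (algebraMap R (Module.End R R)), ← map_sub]
  exact (IsLocalRing.isUnit_or_isUnit_one_sub (f 1)).imp (·.map _) (·.map _)

theorem IsRetract.pi {m : ℕ} {X Y : Fin m → Type u} [∀ i, AddCommGroup (X i)]
    [∀ i, Module R (X i)] [∀ i, AddCommGroup (Y i)] [∀ i, Module R (Y i)]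
    (h : ∀ i, IsRetract R (X i) (Y i)) : IsRetract R (∀ i, X i) (∀ i, Y i) := by
  choose i p hp using h
  refine ⟨LinearMap.piMap i, LinearMap.piMap p, ?_⟩
  apply LinearMap.ext
  intro x
  funext j
  exact LinearMap.congr_fun (hp j) (x j)

open RingTheory.Sequence in
theorem IsRetract.isWeaklyRegular (h : IsRetract R M N) (rs : List R)
    (hrs : IsWeaklyRegular N rs) : IsWeaklyRegular M rs := by
  induction rs generalizing M N with
  | nil => exact .nil R M
  | cons r rs ih =>
    rw [isWeaklyRegular_cons_iff] at hrs ⊢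
    obtain ⟨i, p, hp⟩ := h
    have hi : Function.Injective i :=
      Function.LeftInverse.injective (g := p) (LinearMap.congr_fun hp)
    refine ⟨fun x y hxy => hi (hrs.1 ?_), ih (N := QuotSMulTop r N) ?_ hrs.2⟩
    · change r • i x = r • i y
      rw [← map_smul, ← map_smul]
      exact congrArg i hxy
    · refine ⟨QuotSMulTop.map r i, QuotSMulTop.map r p, ?_⟩
      rw [← QuotSMulTop.map_comp, hp, QuotSMulTop.map_id]

/-- Regular sequences pass to nonzero summands, so the depth of `M` is at least that of `N`, which
is already maximal. -/
theorem IsRetract.cm [IsLocalRing R] [IsNoetherianRing R] {M N : FGModuleCat.{u} R}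
    (h : IsRetract R M N) (hN : CMRad.CM R N) : CMRad.CM R M := by
  rcases subsingleton_or_nontrivial M with hM | hM
  · exact .inl hM
  have := h.nontrivial
  refine .inr (le_antisymm depth_le_ringKrullDim ?_)
  rw [← hN.resolve_left (not_subsingleton_iff_nontrivial.2 this)]
  refine WithBot.coe_le_coe.2 (iSup₂_le fun rs hrs => ?_)
  refine le_iSup₂_of_le rs ⟨hrs.1, ?_⟩ le_rfl
  exact .of_isWeaklyRegular_of_mem_maximalIdeal M hrs.1 (h.isWeaklyRegular rs hrs.2.1)

end

end Module

namespace CMRad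

open Module

section

variable {R : Type u} [CommRing R]

/-- Isomorphism of finitely generated modules. -/
def isoSetoid (R : Type u) [CommRing R] : Setoid (FGModuleCat.{u} R) where
  r M N := Nonempty (M ≃ₗ[R] N)
  iseqv := ⟨fun M => ⟨.refl R M⟩, fun ⟨e⟩ => ⟨e.symm⟩, fun ⟨e⟩ ⟨f⟩ => ⟨e.trans f⟩⟩

/-- Isomorphism classes of finitely generated modules. -/
abbrev IsoClass (R : Type u) [CommRing R] := Quotient (isoSetoid R)

/-- The isomorphism class of a module. -/
def IsoClass.mk (M : FGModuleCat.{u} R) : IsoClass R := Quotient.mk (isoSetoid R) M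

theorem IsoClass.mk_eq_iff {M N : FGModuleCat.{u} R} :
    IsoClass.mk M = IsoClass.mk N ↔ Nonempty (M ≃ₗ[R] N) :=
  Quotient.eq (r := isoSetoid R)

theorem isRetract_of_addClosure {P : CategoryTheory.ObjectProperty (FGModuleCat.{u} R)} {M : FGModuleCat.{u} R}
    (h : addClosure P M) [IsLocalRing (Module.End R M)] : ∃ X, P X ∧ IsRetract R M X := by
  obtain ⟨n, X, N, hX, ⟨e⟩⟩ := h
  obtain ⟨i, hi⟩ := IsRetract.exists_of_pi (fun i => X i) (IsRetract.fst e)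
  exact ⟨X i, hX i, hi⟩

theorem addClosure_of_isRetract {P : CategoryTheory.ObjectProperty (FGModuleCat.{u} R)} [IsNoetherianRing R]
    {M : FGModuleCat.{u} R} {n : ℕ} {X : Fin n → FGModuleCat.{u} R} (hX : ∀ i, P (X i))
    (h : IsRetract R M (∀ i, X i)) : addClosure P M := by
  obtain ⟨p, ⟨e⟩⟩ := h.exists_prod_equiv
  exact ⟨n, X, FGModuleCat.of R (LinearMap.ker p), hX, ⟨e⟩⟩

/-- Up to isomorphism, a finitely generated module over a Henselian Noetherian local ring has only
finitely many direct summands with local endomorphism ring. -/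
theorem finite_isRetract [HenselianLocalRing R] [IsNoetherianRing R] (W : FGModuleCat.{u} R) :
    {q : IsoClass R | ∃ M : FGModuleCat.{u} R, IsoClass.mk M = q ∧
      IsLocalRing (Module.End R M) ∧ IsRetract R M W}.Finite := by
  obtain ⟨n, X, hX, ⟨e⟩⟩ := isSumOfIndecomposables_of_isNoetherian (R := R) (M := W)
  have hret : ∀ i, IsRetract R (X i) W := fun i => IsRetract.proj (fun i => X i) e i
  have hfin : ∀ i, Module.Finite R (X i) := fun i => (hret i).finite
  refine (Set.finite_range fun i => IsoClass.mk ⟨X i, hfin i⟩).subset ?_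
  rintro _ ⟨M, rfl, hM, hMW⟩
  obtain ⟨i, hi⟩ := IsRetract.exists_of_pi (fun i => X i) (hMW.trans (.of_equiv e))
  have : IsLocalRing (Module.End R (X i)) := (hX i).isLocalRing_end
  have : Nontrivial M := nontrivial_of_isLocalRing_end (R := R)
  obtain ⟨f⟩ := hi.equiv_of_isLocalRing
  exact ⟨i, IsoClass.mk_eq_iff.2 ⟨f.symm⟩⟩

variable [IsLocalRing R] [IsNoetherianRing R]

/-- A choice of first syzygy. -/
noncomputable def syzygy (M : FGModuleCat.{u} R) : FGModuleCat.{u} R :=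
  ⟨(exists_isSyzygyOf M).choose, (exists_isSyzygyOf (R := R) M).choose_spec.finite⟩

theorem isSyzygyOf_syzygy (M : FGModuleCat.{u} R) : IsSyzygyOf R M (syzygy M) :=
  (exists_isSyzygyOf (R := R) M).choose_spec

/-- The syzygy operator on isomorphism classes. -/
noncomputable def IsoClass.syzygy : IsoClass R → IsoClass R :=
  Quotient.map' (s₁ := isoSetoid R) (s₂ := isoSetoid R) CMRad.syzygy fun M N ⟨e⟩ =>
    (isSyzygyOf_syzygy M).equiv (isSyzygyOf_syzygy N) e

theorem IsoClass.mk_eq_syzygy {M N : FGModuleCat.{u} R} (h : IsSyzygyOf R M N) :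
    IsoClass.mk N = (IsoClass.mk M).syzygy :=
  IsoClass.mk_eq_iff.2 (h.equiv (isSyzygyOf_syzygy M) (.refl R M))

theorem IsSyzygy.equiv_iterate {i : ℕ} {X C W : FGModuleCat.{u} R} (h : IsSyzygy i X W)
    (e : X ≃ₗ[R] C) : Nonempty (W ≃ₗ[R] (syzygy^[i] C : FGModuleCat.{u} R)) := by
  induction i generalizing W with
  | zero => exact h.map fun f => f.trans e
  | succ i ih =>
    obtain ⟨L, hL, hW⟩ := h
    obtain ⟨f⟩ := ih hL
    rw [Function.iterate_succ_apply']
    exact ((isFirstSyzygy_iff L W).1 hW).equiv (isSyzygyOf_syzygy _) f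

/-- Dimension shifting: `Ext^{j+1}` of the `i`-th syzygy is controlled by `Ext^{i+j+1}(C, R)`. -/
theorem extVanishes_iterate_syzygy {n : ℕ}
    (hn : ∀ (N : Type u) [AddCommGroup N] [Module R N] (i : ℕ), n ≤ i → ExtVanishes R i N)
    (C : FGModuleCat.{u} R) (i j : ℕ) (hj : n ≤ i + j + 1) :
    ExtVanishes R (j + 1) (syzygy^[i] C : FGModuleCat.{u} R) := by
  induction i generalizing j with
  | zero => exact hn _ _ (by lia)
  | succ i ih =>
    rw [Function.iterate_succ_apply']
    obtain ⟨F, f, g, _, _, hf, hfg, hg, -⟩ := isSyzygyOf_syzygy (syzygy^[i] C : FGModuleCat.{u} R)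
    exact ExtVanishes.left hf hfg hg (extVanishes_succ_of_projective j) (ih (j + 1) (by lia))

end

variable {R : Type u} [CommRing R]

/-- The non-free `Ext`-acyclic modules with local endomorphism ring. -/
structure IsNonfreeLocal (M : FGModuleCat.{u} R) : Prop where
  isLocalRing_end : IsLocalRing (Module.End R M)
  isExtAcyclic : IsExtAcyclic R M
  not_equiv : ¬ Nonempty (M ≃ₗ[R] R)

section

variable [HenselianLocalRing R] [IsNoetherianRing R]

theorem IsNonfreeLocal.exists_of_isSyzygyOf {L N M : FGModuleCat.{u} R} (hL : IsExtAcyclic R L)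
    (h : IsSyzygyOf R L N) (hM : IsNonfreeLocal M) (hMN : IsRetract R M N) :
    ∃ L' : FGModuleCat.{u} R, IsNonfreeLocal L' ∧ IsRetract R L' L ∧ IsSyzygyOf R L' M := by
  have := hM.isLocalRing_end
  obtain ⟨L', hL', hloc, hfree, hsyz⟩ := h.exists_retract hL hMN
  exact ⟨L', ⟨hloc, hL'.isExtAcyclic hL, hfree⟩, hL', hsyz⟩

/-- All syzygies of `C` from the `n`-th on are acyclic, so `M` can be traced back one syzygy at a
time to a summand of the `n`-th. -/
theorem IsNonfreeLocal.exists_iterate {n : ℕ} {C M : FGModuleCat.{u} R}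
    (hC : ∀ i, n ≤ i → IsExtAcyclic R (syzygy^[i] C : FGModuleCat.{u} R)) (hM : IsNonfreeLocal M)
    {j : ℕ} (h : IsRetract R M (syzygy^[n + j] C : FGModuleCat.{u} R)) :
    ∃ M' : FGModuleCat.{u} R, IsNonfreeLocal M' ∧
      IsRetract R M' (syzygy^[n] C : FGModuleCat.{u} R) ∧
      IsoClass.mk M = IsoClass.syzygy^[j] (IsoClass.mk M') := by
  induction j generalizing M with
  | zero => exact ⟨M, hM, h, rfl⟩
  | succ j ih =>
    rw [← add_assoc, Function.iterate_succ_apply'] at h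
    obtain ⟨L', hL', hret, hsyz⟩ :=
      IsNonfreeLocal.exists_of_isSyzygyOf (hC (n + j) (by lia)) (isSyzygyOf_syzygy _) hM h
    obtain ⟨M', hM', hret', heq⟩ := ih hL' hret
    refine ⟨M', hM', hret', ?_⟩
    rw [Function.iterate_succ_apply', ← heq]
    exact IsoClass.mk_eq_syzygy hsyz

end

section

variable [HenselianLocalRing R] [IsGorensteinLocalRing R]

/-- The embedding of `M` in a free module with acyclic cokernel is automatically minimal because `M`
is not free. An indecomposable summand of the cokernel already has syzygy `M`. -/
theorem IsNonfreeLocal.exists_syzygy_eq {M : FGModuleCat.{u} R} (hM : IsNonfreeLocal M) :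
    ∃ L : FGModuleCat.{u} R, IsNonfreeLocal L ∧ IsSyzygyOf R L M := by
  obtain ⟨k, f, hf, hN⟩ := hM.isExtAcyclic.exists_cosyzygy
  have := hM.isLocalRing_end
  let N : FGModuleCat.{u} R := FGModuleCat.of R ((Fin k → R) ⧸ LinearMap.range f)
  have hsyz : IsSyzygyOf R N M := (isFirstSyzygy_iff N M).1
    ⟨k, f, (LinearMap.range f).mkQ, hf, f.exact_map_mkQ_range, Submodule.mkQ_surjective _,
      range_le_maximalIdeal_smul hM.not_equiv f⟩
  obtain ⟨L, hL, -, hLM⟩ := IsNonfreeLocal.exists_of_isSyzygyOf (L := N) hN hsyz hM .refl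
  exact ⟨L, hL, hLM⟩

/-- If the non-free `Ext`-acyclic modules with local endomorphism ring are contained in the ball
of radius one around a module `C`, there are only finitely many of them. -/
theorem finite_isNonfreeLocal {C : FGModuleCat.{u} R}
    (hC : ∀ M : FGModuleCat.{u} R, IsNonfreeLocal M → bracket (single C) M) :
    {q : IsoClass R | ∃ M : FGModuleCat.{u} R, IsoClass.mk M = q ∧ IsNonfreeLocal M}.Finite := by
  obtain ⟨n, hn⟩ := exists_extVanishes_of_le R
  have hsyz : ∀ i, n ≤ i → IsExtAcyclic R (syzygy^[i] C : FGModuleCat.{u} R) :=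
    fun i hi j => extVanishes_iterate_syzygy hn C i j (by lia)
  have hret : ∀ M : FGModuleCat.{u} R, IsNonfreeLocal M →
      ∃ i, IsRetract R M (syzygy^[i] C : FGModuleCat.{u} R) := by
    intro M hM
    have := hM.isLocalRing_end
    have : Nontrivial M := nontrivial_of_isLocalRing_end (R := R)
    obtain ⟨X, hX, hMX⟩ := isRetract_of_addClosure (hC M hM)
    rcases hX with ⟨⟨e⟩⟩ | ⟨i, Y, ⟨e⟩, hX⟩
    · have := isLocalRing_end_self R
      exact (hM.not_equiv ((hMX.trans (.of_equiv e)).equiv_of_isLocalRing)).elim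
    · obtain ⟨f⟩ := hX.equiv_iterate e
      exact ⟨i, hMX.trans (.of_equiv f)⟩
  -- The starting points: summands of the finitely many syzygies of `C` up to the `n`-th, where
  -- acyclicity is not yet guaranteed.
  let B : Set (IsoClass R) := {q | ∃ M : FGModuleCat.{u} R, IsoClass.mk M = q ∧ IsNonfreeLocal M ∧
    ∃ i ≤ n, IsRetract R M (syzygy^[i] C : FGModuleCat.{u} R)}
  have hB : B.Finite := by
    refine ((Set.finite_Iic n).biUnion fun i _ =>
      finite_isRetract (syzygy^[i] C : FGModuleCat.{u} R)).subset ?_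
    rintro _ ⟨M, rfl, hM, i, hi, hMi⟩
    exact Set.mem_biUnion hi ⟨M, rfl, hM.isLocalRing_end, hMi⟩
  refine hB.of_iterate IsoClass.syzygy (fun q ⟨M, hq, hM, _⟩ => ⟨M, hq, hM⟩) ?_ ?_
  · rintro _ ⟨M, rfl, hM⟩
    obtain ⟨i, hi⟩ := hret M hM
    rcases le_total i n with h | h
    · exact ⟨_, ⟨M, rfl, hM, i, h, hi⟩, 0, rfl⟩
    · obtain ⟨j, rfl⟩ := Nat.exists_eq_add_of_le h
      obtain ⟨M', hM', hret', heq⟩ := hM.exists_iterate hsyz hi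
      exact ⟨_, ⟨M', rfl, hM', n, le_rfl, hret'⟩, j, heq⟩
  · rintro _ ⟨M, rfl, hM⟩
    obtain ⟨L, hL, hLM⟩ := hM.exists_syzygy_eq
    exact ⟨_, ⟨L, rfl, hL⟩, IsoClass.mk_eq_syzygy hLM⟩

theorem HasFiniteCMType.of_le_bracket {C : FGModuleCat.{u} R} (hC : CM R ≤ bracket (single C)) :
    HasFiniteCMType R := by
  -- The description of `CM R` by acyclicity needs a nonzero CM module. If there is none, the empty
  -- list of indecomposables suffices.
  by_cases h : ∃ M : FGModuleCat.{u} R, CM R M ∧ Nontrivial M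
  · obtain ⟨M₀, h₀, h₀'⟩ := h
    have hcm := cm_iff_isExtAcyclic h₀ h₀'
    have hfin := finite_isNonfreeLocal (C := C) fun M hM => hC M ((hcm M).2 hM.isExtAcyclic)
    let U : Set (IsoClass R) := {q | ∃ M : FGModuleCat.{u} R, IsoClass.mk M = q ∧ CM R M ∧
      CategoryTheory.Indecomposable M.obj}
    have hU : U.Finite := by
      refine (hfin.union (Set.finite_singleton (IsoClass.mk (FGModuleCat.of R R)))).subset ?_
      rintro _ ⟨M, rfl, hM, hM'⟩
      by_cases hR : Nonempty (M ≃ₗ[R] R)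
      · exact .inr (IsoClass.mk_eq_iff.2 hR)
      · exact .inl ⟨M, rfl, ((isIndecomposable_iff M.obj).1 hM').isLocalRing_end, (hcm M).1 hM, hR⟩
    have : Finite U := hU
    obtain ⟨n, ⟨e⟩⟩ := Finite.exists_equiv_fin U
    choose X hX hX' using fun i : Fin n => (e.symm i).2
    refine ⟨n, X, hX', fun M hM hM' => ⟨e ⟨_, M, rfl, hM, hM'⟩, ?_⟩⟩
    rw [← IsoClass.mk_eq_iff, hX, e.symm_apply_apply]
  · refine ⟨0, fun i => i.elim0, fun i => i.elim0, fun M hM hM' => (h ⟨M, hM, ?_⟩).elim⟩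
    exact ((isIndecomposable_iff M.obj).1 hM').1

end

theorem HasFiniteCMType.exists_le_bracket [IsLocalRing R] [IsNoetherianRing R]
    (h : HasFiniteCMType R) : ∃ C : FGModuleCat.{u} R, CM R ≤ bracket (single C) := by
  obtain ⟨n, X, hX, hcover⟩ := h
  let C : FGModuleCat.{u} R := FGModuleCat.of R (∀ i, X i)
  refine ⟨C, fun M hM => ?_⟩
  obtain ⟨m, Y, hY, ⟨e⟩⟩ := isSumOfIndecomposables_of_isNoetherian (R := R) (M := M)
  have hret : ∀ j, IsRetract R (Y j) M := fun j => IsRetract.proj (fun j => Y j) e j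
  have hYC : ∀ j, IsRetract R (Y j) C := by
    intro j
    let Y' : FGModuleCat.{u} R := ⟨Y j, (hret j).finite⟩
    obtain ⟨i, ⟨f⟩⟩ := hcover Y' (IsRetract.cm (M := Y') (hret j) hM)
      ((isIndecomposable_iff (Y j)).2 (hY j))
    exact IsRetract.trans (.of_equiv f) (IsRetract.proj (fun i => X i) (.refl R C) i)
  exact addClosure_of_isRetract (X := fun _ : Fin m => C)
    (fun _ => .inr ⟨0, C, ⟨.refl R C⟩, ⟨.refl R C⟩⟩)
    (IsRetract.trans (.of_equiv e) (IsRetract.pi hYC))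

theorem radius_eq_zero_iff [IsLocalRing R] {P : CategoryTheory.ObjectProperty (FGModuleCat.{u} R)} :
    radius P = 0 ↔ ∃ C : FGModuleCat.{u} R, P ≤ bracket (single C) := by
  constructor
  · intro h
    by_contra hC
    -- Radius zero means the ball of index `0 + 1`, which is the bracket. If that fails for every
    -- center, only indices `n ≥ 1` enter the infimum.
    have : (1 : ℕ∞) ≤ radius P := by
      refine le_iInf₂ fun n hn => ?_
      rcases n with _ | n
      · exact (hC hn).elim
      · exact_mod_cast Nat.le_add_left 1 n
    rw [h] at this
    exact absurd this (by simp)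
  · intro h
    exact le_antisymm (iInf₂_le_of_le 0 h le_rfl) zero_le

end CMRad

end

theorem proposition10 (R : Type u) [CommRing R] [HenselianLocalRing R]
    [CMRad.IsGorensteinLocalRing R] :
    CMRad.radius (CMRad.CM R) = 0 ↔ CMRad.HasFiniteCMType R := by
  rw [CMRad.radius_eq_zero_iff]
  exact ⟨fun ⟨_, hC⟩ => .of_le_bracket hC, fun h => h.exists_le_bracket⟩
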